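/- **Conventions.** For $-A$ the generator of a $C_0$-semigroup $T(\cdot)$ on a Banach space $X$, an *observation operator* is a linear map $C:D(A)\to Y$ that is bounded for the graph norm of $A$; it is *scalar* if $Y=\mathbb C$. The pair $(A,C)$ satisfies the *Weiss condition* if the operators $(\operatorname{Re}\lambda)^{1/2}C(\lambda+A)^{-1}$, $\operatorname{Re}\lambda>0$, are uniformly bounded. For a measurable function $f$ put $d_f(\alpha)=\mu\{|f|>\alpha\}$ and $f^*(t)=\inf\{s>0: d_f(s)\le t\}$. The Lorentz space $L^{2,q}$ is given by finiteness of $\bigl(\int_0^\infty (t^{1/2}f^*(t))^q\,\frac{dt}{t}\bigr)^{1/q}$ for $1\le q<\infty$ and of $\sup_{\alpha>0}\alpha\, d_f(\alpha)^{1/2}$ for $q=\infty$. $C$ is *$L^{2,q}(J)$-admissible* if $x\mapsto CT(\cdot)x$ is bounded from $X$ to $L^{2,q}(J;Y)$. **Theorem.** 1. There are an exponentially stable, bounded analytic semigroup $T(\cdot)$ on a Hilbert space $H$, a scalar observation operator $C$ and an $x\in H$ such that the (continuous) function $t\mapsto CT(t)x$, $t>0$, lies in no space $L^{2,q}(0,\tau)$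 with $1\le q<\infty$ and $\tau>0$. 2. Weak-$L^2=L^{2,\infty}$ is the endpoint of the Lorentz scale for the Weiss conjecture, in the following sense. Let $2<q<\infty$ and $\beta=\frac1{2q'}=\frac12\bigl(1-\frac1q\bigr)\in(\frac14,\frac12)$. In $H=L^2(-\pi,\pi)$ let $$e_{2n}(s)=|s|^\beta e^{ins}\quad(n\ge 0),\qquad e_{2n-1}(s)=|s|^\beta e^{-ins}\quad(n\ge 1).$$ Then $(e_n)_{n\ge0}$ is a conditional (that is, not unconditional) Schauder basis of $H$. There is an exponentially stable, bounded analytic semigroup $T(\cdot)$ on $H$ with $T(t)e_n=e^{-4^nt}e_n$ for all $n\ge 0$, $t\ge0$. There is a scalar observation operator $C$ for it with $e_n\in D(A)$ and $Ce_n=2^n$ for all $n\ge0$, and $C$ satisfies the Weiss condition and is $L^{2,\infty}(0,\infty)$-admissible. The function $x(s)=|s|^{-\beta}$ belongs to $H$. Its coefficients in $x=\sum_n\xi_ne_n$ satisfy $\xi_n\ge0$ for all $n$, and $n^{1/q}\xi_n$ converges to a positive number as $n\to\infty$. Moreover $$CT(\cdot)x\notin L^{2,p}(0,\tau)\qquad\text{for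 all }1\le p\le q\text{ and all }\tau>0 .$$ -/

import Mathlib

open MeasureTheory Filter Topology Set
open scoped ENNReal NNReal

noncomputable section

section Lorentz

variable {Ω Y : Type*} [MeasurableSpace Ω] [NormedAddCommGroup Y]

/-- The distribution function `d_f(α) = μ {ω : ‖f ω‖ > α}`. -/
def distribFun (f : Ω → Y) (μ : Measure Ω) (α : ℝ≥0∞) : ℝ≥0∞ :=
  μ {ω | α < ‖f ω‖ₑ}

/-- The decreasing rearrangement `f^*(t) = inf {s > 0 : d_f(s) ≤ t}`. -/
def rearr (f : Ω → Y) (μ : Measure Ω) (t : ℝ) : ℝ≥0∞ :=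
  sInf {s : ℝ≥0∞ | 0 < s ∧ distribFun f μ s ≤ ENNReal.ofReal t}

/-- The Lorentz (quasi-)norm of `L^{p,q}`, with values in `[0, ∞]`:
`(∫_0^∞ (t^{1/p} f^*(t))^q dt/t)^{1/q}` for `q < ∞`,
and `sup_{α > 0} α d_f(α)^{1/p}` for `q = ∞`. -/
def eLorentzNorm (f : Ω → Y) (p : ℝ) (q : ℝ≥0∞) (μ : Measure Ω) : ℝ≥0∞ :=
  if q = ⊤ then
    ⨆ (α : ℝ≥0) (_ : 0 < α), (α : ℝ≥0∞) * distribFun f μ α ^ (1 / p)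
  else
    (∫⁻ t in Ioi (0 : ℝ),
      (ENNReal.ofReal (t ^ (1 / p)) * rearr f μ t) ^ q.toReal * ENNReal.ofReal t⁻¹)
        ^ (1 / q.toReal)

/-- Membership in the Lorentz–Bochner space `L^{p,q}(Ω, μ; Y)`. -/
def MemLorentz (f : Ω → Y) (p : ℝ) (q : ℝ≥0∞) (μ : Measure Ω) : Prop :=
  AEStronglyMeasurable f μ ∧ eLorentzNorm f p q μ < ⊤

end Lorentz

section Semigroups

/-- A strongly continuous semigroup `(T(t))_{t ≥ 0}` of bounded operators on `X`
(the values at `t < 0` play no role). -/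
structure C0Semigroup (X : Type*) [NormedAddCommGroup X] [NormedSpace ℂ X] where
  /-- The operators of the semigroup. -/
  op : ℝ → X →L[ℂ] X
  op_zero : op 0 = ContinuousLinearMap.id ℂ X
  op_add : ∀ s t : ℝ, 0 ≤ s → 0 ≤ t → op (s + t) = (op s).comp (op t)
  tendsto_op : ∀ x : X, Tendsto (fun t : ℝ => op t x) (𝓝[>] 0) (𝓝 x)

/-- The open sector `{z ≠ 0 : |arg z| < δ}`. -/
def openSector (δ : ℝ) : Set ℂ := {z | z ≠ 0 ∧ |z.arg| < δ}

namespace C0Semigroup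

variable {X : Type*} [NormedAddCommGroup X] [NormedSpace ℂ X] (T : C0Semigroup X)

/-- The difference quotient `t⁻¹ (x - T(t) x)`. -/
def quot (x : X) (t : ℝ) : X := ((t⁻¹ : ℝ) : ℂ) • (x - T.op t x)

/-- The operator `A` for which `-A` is the generator of `T`: its domain consists of all `x` such
that `t⁻¹ (x - T(t) x)` converges as `t → 0+`, and `A x` is the limit. -/
def negGen : X →ₗ.[ℂ] X where
  domain :=
    { carrier := {x | ∃ y, Tendsto (T.quot x) (𝓝[>] 0) (𝓝 y)}
      add_mem' := by
        rintro a b ⟨y, hy⟩ ⟨z, hz⟩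
        refine ⟨y + z, (hy.add hz).congr fun t => ?_⟩
        simp only [quot, map_add, ← smul_add]
        congr 1; abel
      zero_mem' := ⟨0, tendsto_const_nhds.congr fun t => by simp [quot]⟩
      smul_mem' := by
        rintro c a ⟨y, hy⟩
        refine ⟨c • y, (hy.const_smul c).congr fun t => ?_⟩
        simp only [quot, map_smul, ← smul_sub]
        rw [smul_comm] }
  toFun :=
    { toFun := fun x => x.2.choose
      map_add' := by
        intro a b
        refine tendsto_nhds_unique (a + b).2.choose_spec
          ((a.2.choose_spec.add b.2.choose_spec).congr fun t => ?_)
        simp only [quot, Submodule.coe_add, map_add, ← smul_add]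
        congr 1; abel
      map_smul' := by
        intro c a
        refine tendsto_nhds_unique (c • a).2.choose_spec
          ((a.2.choose_spec.const_smul c).congr fun t => ?_)
        simp only [quot, Submodule.coe_smul, map_smul, ← smul_sub]
        rw [smul_comm] }

/-- Exponential stability: `‖T(t)‖ ≤ M e^{-ωt}` for all `t ≥ 0`, with some `ω > 0`. -/
def IsExpStable : Prop :=
  ∃ M ω : ℝ, 0 < ω ∧ ∀ t : ℝ, 0 ≤ t → ‖T.op t‖ ≤ M * Real.exp (-ω * t)

/-- Bounded analytic semigroups: `T` extends to a holomorphic (in operator norm) semigroup on a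
sector of half-angle `δ > 0`, which on each smaller sector is bounded and strongly continuous
at `0`. -/
def IsBoundedAnalytic : Prop :=
  ∃ δ : ℝ, 0 < δ ∧ δ ≤ Real.pi / 2 ∧ ∃ S : ℂ → X →L[ℂ] X,
    (∀ t : ℝ, 0 < t → S t = T.op t) ∧
    (∀ z ∈ openSector δ, ∀ w ∈ openSector δ, S (z + w) = (S z).comp (S w)) ∧
    DifferentiableOn ℂ S (openSector δ) ∧
    ∀ δ' : ℝ, 0 < δ' → δ' < δ →
      (∀ x : X, Tendsto (fun z => S z x) (𝓝[openSector δ'] 0) (𝓝 x)) ∧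
      ∃ M : ℝ, ∀ z ∈ openSector δ', ‖S z‖ ≤ M

end C0Semigroup

/-- An observation operator for `T`: a linear map `D(A) → Y` that is bounded with respect to
the graph norm of `D(A)`. -/
structure ObsOperator {X : Type*} [NormedAddCommGroup X] [NormedSpace ℂ X] (T : C0Semigroup X)
    (Y : Type*) [NormedAddCommGroup Y] [NormedSpace ℂ Y] where
  /-- The underlying linear map on `D(A)`. -/
  map : T.negGen.domain →ₗ[ℂ] Y
  bound : ∃ K : ℝ, ∀ x : T.negGen.domain, ‖map x‖ ≤ K * (‖(x : X)‖ + ‖T.negGen x‖)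

namespace ObsOperator

variable {X : Type*} [NormedAddCommGroup X] [NormedSpace ℂ X] {T : C0Semigroup X}
  {Y : Type*} [NormedAddCommGroup Y] [NormedSpace ℂ Y] (C : ObsOperator T Y)

open scoped Classical in
/-- The observed orbit `t ↦ C T(t) x`; it takes the value `0` at those `t` for which `T(t) x` is
not in `D(A)` (there are none with `t > 0` when `T` is analytic). -/
def orbit (x : X) (t : ℝ) : Y :=
  if h : T.op t x ∈ T.negGen.domain then C.map ⟨T.op t x, h⟩ else 0

/-- The Weiss condition: for `Re λ > 0` the operator `λ + A` is invertible and the operators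
`(Re λ)^{1/2} C (λ + A)^{-1}` are uniformly bounded. -/
def Weiss : Prop :=
  ∃ K : ℝ, ∀ l : ℂ, 0 < l.re →
    Function.Bijective (fun x : T.negGen.domain => l • (x : X) + T.negGen x) ∧
    ∀ x : T.negGen.domain, Real.sqrt l.re * ‖C.map x‖ ≤ K * ‖l • (x : X) + T.negGen x‖

/-- `L^{p,q}(J; Y)`-admissibility: `x ↦ C T(·) x` is bounded from `X` to `L^{p,q}(J; Y)`. -/
def LorentzAdmissible (p : ℝ) (q : ℝ≥0∞) (J : Set ℝ) : Prop :=
  ∃ K : ℝ≥0, ∀ x : X, MemLorentz (C.orbit x) p q (volume.restrict J) ∧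
    eLorentzNorm (C.orbit x) p q (volume.restrict J) ≤ K * ‖x‖ₑ

end ObsOperator

end Semigroups

section Example

/-- The Hilbert space `L²(-π, π)`. -/
abbrev L2pi : Type := Lp ℂ 2 (volume.restrict (Ioo (-Real.pi) Real.pi))

/-- The enumeration `0, -1, 1, -2, 2, …` of the integers. -/
def freq (n : ℕ) : ℤ := if Even n then (n / 2 : ℕ) else -((n + 1) / 2 : ℕ)

/-- The functions `|s|^β e^{iks}`, with `k` running through `0, -1, 1, -2, 2, …`. -/
def weightedExp (β : ℝ) (n : ℕ) (s : ℝ) : ℂ :=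
  ((|s| ^ β : ℝ) : ℂ) * Complex.exp (Complex.I * (freq n : ℂ) * (s : ℂ))

end Example

end

/-! Everything is diagonal with respect to a Schauder basis `e` of `L²(-π, π)` with bounded
coordinate functionals: `A e_n = 4^n e_n` and `C e_n = r^n`. A sequence of bounded variation tending
to `0` acts as a bounded multiplier, by summation by parts against the partial sum projections. This
yields the analytic semigroup without unconditionality. Since `C` is `A` followed by the functional
`∑ (r/4)^n e_n^*`, it is an observation operator whenever `0 ≤ r < 4`.

For `r = 2` the positive results use only `sup ‖e_n^*‖ < ∞`. The estimate `∑ 2^n / (4^n + a) ≤ 4 /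
√a` gives `|C T(t) x| ≲ t^{-1/2} ‖x‖`, hence weak-`L²` admissibility, and with `a = Re λ` the Weiss
condition (`norm_orbit_le`, `weiss_observation`). Conversely, if `x` has coefficients `ξ_n ≥ 0`, no
cancellation occurs and `|C T(t) x| ≥ e^{-1} r^n ξ_n` for `t ≤ 4^{-n}`. On blocks of ratio `4` the
`L^{2,p}` norm then dominates the `ℓ^p` norm of `(r/2)^n ξ_n` up to finitely many terms
(`not_memLorentz_of_not_summable`). It remains to find a basis and an `x` with `ξ_n ~ n^{-1/q}`. For
`r = 2` this excludes every `p ≤ q`; for `r = 3` the factor `(3/2)^n` excludes every finite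
exponent, which is the first assertion.

For the weighted exponentials `|s|^β e^{iks}`, the partial sum operators differ from the classical
Fourier ones by a kernel dominated, uniformly in `N`, by `|t|^{-β} max(|s|,|t|)^{β-1}`
(`norm_weighted_dirichletSum_sub_le`). This kernel is homogeneous of degree `-1` and is bounded on
`L²` by the Schur test, because `β < 1/2`. The coefficients of `|s|^{-β}` are cosine integrals of
`s^{-2β}` with `2β = 1 - 1/q`; integration by parts gives their sign and asymptotics. By Orlicz's
theorem an unconditional basis would make them square summable, which fails for `q > 2`. -/

noncomputable section

/-! ### Elementary estimates for exponentials and lacunary sums. -/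

section RealLemmas

/-- Telescoping. It is the source of the variation bounds that are uniform in the parameter. -/
lemma summable_of_sub_le {m : ℕ → ℂ} {g : ℕ → ℝ} {c : ℝ} (hc : 0 ≤ c) (hg : ∀ n, 0 ≤ g n)
    (h : ∀ n, ‖m n - m (n + 1)‖ ≤ c * (g n - g (n + 1))) :
    Summable (fun n => ‖m n - m (n + 1)‖) ∧ ∑' n, ‖m n - m (n + 1)‖ ≤ c * g 0 := by
  have key : ∀ N, ∑ n ∈ Finset.range N, ‖m n - m (n + 1)‖ ≤ c * g 0 := by
    intro N
    calc _ ≤ ∑ n ∈ Finset.range N, c * (g n - g (n + 1)) := Finset.sum_le_sum fun n _ => h n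
      _ = c * (g 0 - g N) := by rw [← Finset.mul_sum, Finset.sum_range_sub']
      _ ≤ c * g 0 := by
        gcongr
        linarith [hg N]
  exact ⟨summable_of_sum_range_le (fun _ => norm_nonneg _) key,
    Real.tsum_le_of_sum_range_le (fun _ => norm_nonneg _) key⟩

/-- The left side is at most the integral of `|z| e^{-x Re z}` over `[a, b]`, which the right side
evaluates; the proof compares derivatives. The factor `|z| / Re z` is bounded on every smaller
sector. -/
lemma norm_cexp_sub_cexp_le {z : ℂ} (hz : 0 < z.re) {a b : ℝ} (hab : a ≤ b) :
    ‖Complex.exp (-a * z) - Complex.exp (-b * z)‖ ≤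
      ‖z‖ / z.re * (Real.exp (-a * z.re) - Real.exp (-b * z.re)) := by
  have hd : ∀ x : ℝ, HasDerivAt (fun x : ℝ => Complex.exp (-x * z) - Complex.exp (-a * z))
      (Complex.exp (-x * z) * (-z)) x := by
    intro x
    have h1 : HasDerivAt (fun x : ℝ => -(x : ℂ) * z) (-1 * z) x :=
      ((Complex.ofRealCLM.hasDerivAt (x := x)).neg).mul_const z
    simpa using h1.cexp.sub_const (Complex.exp (-a * z))
  have hB : ∀ x : ℝ, HasDerivAt
      (fun x : ℝ => ‖z‖ / z.re * (Real.exp (-a * z.re) - Real.exp (-x * z.re)))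
      (‖z‖ * Real.exp (-x * z.re)) x := by
    intro x
    have h1 : HasDerivAt (fun x : ℝ => -x * z.re) (-1 * z.re) x :=
      ((hasDerivAt_id x).neg).mul_const z.re
    have h2 := (h1.exp.const_sub (Real.exp (-a * z.re))).const_mul (‖z‖ / z.re)
    have h3 : ‖z‖ / z.re * -(Real.exp (-x * z.re) * (-1 * z.re)) = ‖z‖ * Real.exp (-x * z.re) := by
      field_simp
    rwa [h3] at h2
  have := image_norm_le_of_norm_deriv_right_le_deriv_boundary (a := a) (b := b)
    (f := fun x : ℝ => Complex.exp (-x * z) - Complex.exp (-a * z))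
    (fun x _ => (hd x).continuousAt.continuousWithinAt)
    (fun x _ => (hd x).hasDerivWithinAt) (by simp) hB
    (fun x _ => by
      rw [norm_mul, Complex.norm_exp, norm_neg, mul_comm]
      simp) (right_mem_Icc.2 hab)
  rwa [norm_sub_rev]

/-- Secant slopes of the convex function `exp` through `0` are monotone. -/
lemma antitone_one_sub_exp_div {a b : ℝ} (ha : 0 < a) (hab : a ≤ b) :
    (1 - Real.exp (-b)) / b ≤ (1 - Real.exp (-a)) / a := by
  have h := convexOn_exp.secant_mono (a := 0) (x := -b) (y := -a) trivial trivial trivial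
    (by linarith) (by linarith) (by linarith)
  simp only [Real.exp_zero, sub_zero] at h
  have e1 : ∀ c : ℝ, (Real.exp (-c) - 1) / -c = (1 - Real.exp (-c)) / c := fun c => by
    rw [div_neg, ← neg_div, neg_sub]
  rwa [e1, e1] at h

lemma four_pow_mul_exp_le {t : ℝ} (ht : 0 < t) (n : ℕ) :
    4 ^ n * Real.exp (-4 ^ n * t) ≤ 2 / t ^ 2 * (1 / 4 : ℝ) ^ n := by
  have h4 : (0 : ℝ) < 4 ^ n := by positivity
  have h1 := Real.quadratic_le_exp_of_nonneg (x := 4 ^ n * t) (by positivity)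
  rw [neg_mul, Real.exp_neg, one_div, inv_pow, ← div_eq_mul_inv, ← div_eq_mul_inv, div_div,
    div_le_div_iff₀ (Real.exp_pos _) (by positivity)]
  nlinarith [mul_pos h4 ht, h4]

/-- With `s = √a` and `u = 2^n`, each term is dominated by an increment of `u / (u + s)` between `u`
and `2u`, so the sum telescopes. The value `a = 1/t` serves the orbit and `a = Re λ` the resolvent.
-/
lemma tsum_two_pow_div_le {a : ℝ} (ha : 0 < a) :
    Summable (fun n : ℕ => (2 : ℝ) ^ n / (4 ^ n + a)) ∧
      ∑' n : ℕ, (2 : ℝ) ^ n / (4 ^ n + a) ≤ 4 / √a := by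
  have hs : 0 < √a := Real.sqrt_pos.2 ha
  set s := √a with hs_def
  have hsa : a = s ^ 2 := (Real.sq_sqrt ha.le).symm
  have key : ∀ n : ℕ, (2 : ℝ) ^ n / (4 ^ n + a) ≤
      4 / s * (2 ^ (n + 1) / (2 ^ (n + 1) + s) - 2 ^ n / (2 ^ n + s)) := by
    intro n
    have h2 : (0 : ℝ) < 2 ^ n := by positivity
    rw [show (4 : ℝ) ^ n = (2 ^ n) ^ 2 by rw [← pow_mul, mul_comm, pow_mul]; norm_num, hsa,
      pow_succ 2 n]
    generalize (2 : ℝ) ^ n = u at h2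
    have : 4 / s * (u * 2 / (u * 2 + s) - u / (u + s)) = 4 * u / ((u * 2 + s) * (u + s)) := by
      field_simp; ring
    rw [this, div_le_div_iff₀ (by positivity) (by positivity)]
    nlinarith [mul_pos h2 hs, sq_nonneg (u - s), mul_nonneg h2.le (sq_nonneg (u - s)),
      mul_nonneg h2.le (sq_nonneg u), mul_nonneg h2.le (sq_nonneg s)]
  have bd : ∀ N, ∑ n ∈ Finset.range N, (2 : ℝ) ^ n / (4 ^ n + a) ≤ 4 / s := by
    intro N
    calc _ ≤ ∑ n ∈ Finset.range N,
          4 / s * ((2 : ℝ) ^ (n + 1) / (2 ^ (n + 1) + s) - 2 ^ n / (2 ^ n + s)) :=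
        Finset.sum_le_sum fun n _ => key n
      _ = 4 / s * ((2 : ℝ) ^ N / (2 ^ N + s) - 1 / (1 + s)) := by
        rw [← Finset.mul_sum, Finset.sum_range_sub (fun n => (2 : ℝ) ^ n / (2 ^ n + s))]
        simp
      _ ≤ 4 / s * 1 := by
        gcongr
        have h1 : (2 : ℝ) ^ N / (2 ^ N + s) ≤ 1 := by
          rw [div_le_one (by positivity)]; linarith
        have : 0 < 1 / (1 + s) := by positivity
        linarith
      _ = 4 / s := mul_one _
  exact ⟨summable_of_sum_range_le (fun _ => by positivity) bd,
    Real.tsum_le_of_sum_range_le (fun _ => by positivity) bd⟩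

end RealLemmas

/-! ### Multipliers of bounded variation on a Schauder basis. -/

section Multiplier

variable {X : Type*} [NormedAddCommGroup X] [NormedSpace ℂ X] (e : SchauderBasis ℂ X)

lemma SchauderBasis.ext_coord {x y : X} (h : ∀ n, e.coord n x = e.coord n y) : x = y := by
  have hx := e.expansion x
  simp_rw [h] at hx
  exact hx.unique (e.expansion y)

lemma SchauderBasis.coord_proj (k n : ℕ) (x : X) :
    e.coord k (SchauderBasis.proj e n x) = if k < n then e.coord k x else 0 := by
  simp [SchauderBasis.proj_apply, e.ortho, Pi.single_apply]

/-- The multiplier operator with symbol `m`, defined by summation by parts. -/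
def SchauderBasis.multiplier (m : ℕ → ℂ) : X →L[ℂ] X :=
  ∑' n, (m n - m (n + 1)) • SchauderBasis.proj e (n + 1)

lemma SchauderBasis.norm_multiplier_le {e : SchauderBasis ℂ X} {m : ℕ → ℂ} {K : ℝ}
    (hK : ∀ n, ‖SchauderBasis.proj e n‖ ≤ K) (hm : Summable fun n => ‖m n - m (n + 1)‖) :
    ‖SchauderBasis.multiplier e m‖ ≤ (∑' n, ‖m n - m (n + 1)‖) * K := by
  refine tsum_of_norm_bounded (hm.hasSum.mul_right K) fun n => ?_
  rw [norm_smul]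
  gcongr
  exact hK _

variable [CompleteSpace X]

lemma SchauderBasis.exists_pos_norm_proj_le :
    ∃ K : ℝ, 0 < K ∧ ∀ n, ‖SchauderBasis.proj e n‖ ≤ K := by
  obtain ⟨K, hK⟩ := SchauderBasis.exists_norm_proj_le e
  exact ⟨max K 1, by positivity, fun n => (hK n).trans (le_max_left _ _)⟩

variable {e} {m : ℕ → ℂ}

lemma SchauderBasis.hasSum_multiplier (hm : Summable fun n => ‖m n - m (n + 1)‖) :
    HasSum (fun n => (m n - m (n + 1)) • SchauderBasis.proj e (n + 1))
      (SchauderBasis.multiplier e m) := by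
  obtain ⟨K, hK0, hK⟩ := SchauderBasis.exists_pos_norm_proj_le e
  refine Summable.hasSum (Summable.of_norm_bounded (hm.mul_right K) fun n => ?_)
  rw [norm_smul]
  gcongr
  exact hK _

/-- The `n`-th projection in the series keeps coordinate `k` exactly when `n ≥ k`, so the partial
sums telescope to `m k - m N`. The hypothesis `h0` removes the remainder. -/
lemma SchauderBasis.coord_multiplier (hm : Summable fun n => ‖m n - m (n + 1)‖)
    (h0 : Tendsto m atTop (𝓝 0)) (k : ℕ) (x : X) :
    e.coord k (SchauderBasis.multiplier e m x) = m k * e.coord k x := by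
  have h1 : HasSum (fun n => (m n - m (n + 1)) * e.coord k (SchauderBasis.proj e (n + 1) x))
      (e.coord k (SchauderBasis.multiplier e m x)) := by
    have := ((e.coord k).comp (ContinuousLinearMap.apply ℂ X x)).hasSum
      (SchauderBasis.hasSum_multiplier (e := e) hm)
    simpa using this
  refine tendsto_nhds_unique h1.tendsto_sum_nat ?_
  have h2 : Tendsto (fun N => (m k - m N) * e.coord k x) atTop (𝓝 ((m k - 0) * e.coord k x)) :=
    (tendsto_const_nhds.sub h0).mul_const _
  rw [sub_zero] at h2
  refine h2.congr' ?_
  filter_upwards [eventually_ge_atTop k] with N hN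
  induction N, hN using Nat.le_induction with
  | base =>
    rw [sub_self, zero_mul, eq_comm]
    refine Finset.sum_eq_zero fun n hn => ?_
    rw [SchauderBasis.coord_proj, if_neg (by have := Finset.mem_range.1 hn; omega), mul_zero]
  | succ N hN ih =>
    rw [Finset.sum_range_succ, ← ih, SchauderBasis.coord_proj, if_pos (by omega)]
    ring

lemma SchauderBasis.multiplier_basis (hm : Summable fun n => ‖m n - m (n + 1)‖)
    (h0 : Tendsto m atTop (𝓝 0)) (k : ℕ) :
    SchauderBasis.multiplier e m (e.basis k) = m k • e.basis k := by
  refine SchauderBasis.ext_coord e fun n => ?_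
  rw [SchauderBasis.coord_multiplier hm h0, map_smul, smul_eq_mul, e.ortho]
  by_cases h : n = k
  · rw [h]
  · simp [h]

/-- Uniform boundedness together with convergence on finite combinations of basis vectors, which are
dense. -/
lemma SchauderBasis.tendsto_multiplier {ι : Type*} {l : Filter ι} {M : ι → ℕ → ℂ} {B : ℝ}
    (hm : ∀ᶠ i in l, Summable fun n => ‖M i n - M i (n + 1)‖)
    (h0 : ∀ᶠ i in l, Tendsto (M i) atTop (𝓝 0))
    (hB : ∀ᶠ i in l, ‖SchauderBasis.multiplier e (M i)‖ ≤ B)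
    (h1 : ∀ n, Tendsto (fun i => M i n) l (𝓝 1)) (x : X) :
    Tendsto (fun i => SchauderBasis.multiplier e (M i) x) l (𝓝 x) := by
  have hB' : ∀ᶠ i in l, ‖SchauderBasis.multiplier e (M i)‖ ≤ max B 0 :=
    hB.mono fun i hi => hi.trans (le_max_left _ _)
  generalize hD : max B 0 = D at hB'
  have hD0 : 0 ≤ D := hD ▸ le_max_right _ _
  rw [Metric.tendsto_nhds]
  intro ε hε
  obtain ⟨N, hN⟩ := ((SchauderBasis.tendsto_proj e x).eventually
    (Metric.ball_mem_nhds x (show 0 < ε / (2 * (D + 1)) by positivity))).exists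
  set p := SchauderBasis.proj e N x with hp
  have hfin : Tendsto (fun i => ∑ k ∈ Finset.range N, M i k • e.coord k x • e.basis k) l (𝓝 p) := by
    have : Tendsto (fun i => ∑ k ∈ Finset.range N, M i k • e.coord k x • e.basis k) l
        (𝓝 (∑ k ∈ Finset.range N, (1 : ℂ) • e.coord k x • e.basis k)) :=
      tendsto_finsetSum _ fun k _ => (h1 k).smul_const _
    simpa [hp, SchauderBasis.proj_apply] using this
  filter_upwards [hm, h0, hB', hfin.eventually (Metric.ball_mem_nhds p (half_pos hε))]
    with i him hi0 hiB hip
  have hMp : SchauderBasis.multiplier e (M i) p =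
      ∑ k ∈ Finset.range N, M i k • e.coord k x • e.basis k := by
    rw [hp, SchauderBasis.proj_apply, map_sum]
    refine Finset.sum_congr rfl fun k _ => ?_
    rw [map_smul, SchauderBasis.multiplier_basis him hi0, smul_comm]
  rw [← hMp] at hip
  have hxp : ‖p - x‖ < ε / (2 * (D + 1)) := by rwa [← dist_eq_norm]
  have hip' : ‖SchauderBasis.multiplier e (M i) p - p‖ < ε / 2 := by rwa [← dist_eq_norm]
  rw [dist_eq_norm]
  calc ‖SchauderBasis.multiplier e (M i) x - x‖
      = ‖-(SchauderBasis.multiplier e (M i) (p - x)) +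
          (SchauderBasis.multiplier e (M i) p - p) + (p - x)‖ := by
        rw [map_sub]; congr 1; abel
    _ ≤ ‖SchauderBasis.multiplier e (M i) (p - x)‖ +
          ‖SchauderBasis.multiplier e (M i) p - p‖ + ‖p - x‖ := by
        rw [← norm_neg (SchauderBasis.multiplier e (M i) (p - x))]; exact norm_add₃_le
    _ ≤ D * ‖p - x‖ + ‖SchauderBasis.multiplier e (M i) p - p‖ + ‖p - x‖ := by
        gcongr
        exact ContinuousLinearMap.le_of_opNorm_le _ hiB _
    _ = (D + 1) * ‖p - x‖ + ‖SchauderBasis.multiplier e (M i) p - p‖ := by ring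
    _ < (D + 1) * (ε / (2 * (D + 1))) + ε / 2 := by
        gcongr
    _ = ε := by field_simp; ring

end Multiplier

/-! ### The diagonal semigroup and its analyticity. -/

section DiagonalSemigroup

variable {X : Type*} [NormedAddCommGroup X] [NormedSpace ℂ X] (e : SchauderBasis ℂ X)

/-- The sequence `(e^{-4^n z})_n`. -/
def expSymbol (z : ℂ) (n : ℕ) : ℂ := Complex.exp (-((4 : ℝ) ^ n : ℝ) * z)

lemma expSymbol_add (z w : ℂ) (n : ℕ) : expSymbol (z + w) n = expSymbol z n * expSymbol w n := by
  rw [expSymbol, expSymbol, expSymbol, ← Complex.exp_add, mul_add]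

lemma norm_expSymbol (z : ℂ) (n : ℕ) : ‖expSymbol z n‖ = Real.exp (-4 ^ n * z.re) := by
  rw [expSymbol, Complex.norm_exp, ← Complex.ofReal_neg, Complex.re_ofReal_mul]

lemma expSymbol_ofReal (t : ℝ) (n : ℕ) : expSymbol t n = (Real.exp (-4 ^ n * t) : ℝ) := by
  rw [expSymbol]; push_cast; rfl

lemma exp_neg_four_pow_le {t : ℝ} (ht : 0 < t) (n : ℕ) :
    Real.exp (-4 ^ n * t) ≤ 2 / t ^ 2 * (1 / 4 : ℝ) ^ n := by
  refine le_trans ?_ (four_pow_mul_exp_le ht n)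
  exact le_mul_of_one_le_left (Real.exp_pos _).le (one_le_pow₀ (by norm_num))

lemma summable_quarter : Summable fun n : ℕ => (1 / 4 : ℝ) ^ n :=
  summable_geometric_of_lt_one (by norm_num) (by norm_num)

lemma tendsto_expSymbol {z : ℂ} (hz : 0 < z.re) : Tendsto (expSymbol z) atTop (𝓝 0) := by
  refine squeeze_zero_norm (a := fun n => 2 / z.re ^ 2 * (1 / 4 : ℝ) ^ n) (fun n => ?_) ?_
  · rw [norm_expSymbol]; exact exp_neg_four_pow_le hz n
  · exact (summable_quarter.mul_left _).tendsto_atTop_zero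

lemma four_pow_le_succ (n : ℕ) : (4 : ℝ) ^ n ≤ 4 ^ (n + 1) :=
  pow_le_pow_right₀ (by norm_num) (Nat.le_succ n)

lemma summable_expSymbol {z : ℂ} (hz : 0 < z.re) :
    Summable (fun n => ‖expSymbol z n - expSymbol z (n + 1)‖) ∧
      ∑' n, ‖expSymbol z n - expSymbol z (n + 1)‖ ≤ ‖z‖ / z.re * Real.exp (-z.re) := by
  have := summable_of_sub_le (m := expSymbol z) (g := fun n => Real.exp (-4 ^ n * z.re))
    (c := ‖z‖ / z.re) (by positivity) (fun n => (Real.exp_pos _).le)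
    (fun n => by
      simpa [expSymbol] using norm_cexp_sub_cexp_le hz (four_pow_le_succ n))
  simpa using this

lemma openSector_subset {δ : ℝ} (hδ : δ ≤ Real.pi / 2) {z : ℂ} (hz : z ∈ openSector δ) :
    0 < z.re ∧ Real.cos δ * ‖z‖ ≤ z.re := by
  obtain ⟨h0, harg⟩ := hz
  have hn : 0 < ‖z‖ := norm_pos_iff.2 h0
  have hre : z.re = ‖z‖ * Real.cos z.arg := (Complex.norm_mul_cos_arg z).symm
  have hlt := lt_of_lt_of_le harg hδ
  constructor
  · rw [hre]
    exact mul_pos hn (Real.cos_pos_of_mem_Ioo (abs_lt.1 hlt))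
  · rw [hre, mul_comm]
    gcongr
    rw [← Real.cos_abs z.arg]
    exact Real.cos_le_cos_of_nonneg_of_le_pi (abs_nonneg _)
      (by linarith [Real.pi_pos]) harg.le

lemma norm_multiplier_expSymbol_le {K : ℝ} (hK : ∀ n, ‖SchauderBasis.proj e n‖ ≤ K) {z : ℂ}
    (hz : 0 < z.re) :
    ‖SchauderBasis.multiplier e (expSymbol z)‖ ≤ ‖z‖ / z.re * Real.exp (-z.re) * K := by
  refine (SchauderBasis.norm_multiplier_le hK (summable_expSymbol hz).1).trans ?_
  have : 0 ≤ K := (norm_nonneg _).trans (hK 0)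
  gcongr
  exact (summable_expSymbol hz).2

variable [CompleteSpace X]

variable {e} in
lemma coord_expSymbol {z : ℂ} (hz : 0 < z.re) (n : ℕ) (x : X) :
    e.coord n (SchauderBasis.multiplier e (expSymbol z) x) = expSymbol z n * e.coord n x :=
  SchauderBasis.coord_multiplier (summable_expSymbol hz).1 (tendsto_expSymbol hz) n x

/-- On the sector `|z| / Re z ≤ 1 / cos δ`, so the multipliers are uniformly bounded there. -/
lemma tendsto_expSymbol_sector {δ : ℝ} (hδ : δ < Real.pi / 2) (h0 : 0 < δ) (x : X) :
    Tendsto (fun z => SchauderBasis.multiplier e (expSymbol z) x) (𝓝[openSector δ] 0) (𝓝 x) := by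
  obtain ⟨K, hK0, hK⟩ := SchauderBasis.exists_pos_norm_proj_le e
  have hcos : 0 < Real.cos δ := Real.cos_pos_of_mem_Ioo ⟨by linarith, hδ⟩
  refine SchauderBasis.tendsto_multiplier (B := (Real.cos δ)⁻¹ * 1 * K) ?_ ?_ ?_ ?_ x
  · filter_upwards [self_mem_nhdsWithin] with z hz
    exact (summable_expSymbol (openSector_subset hδ.le hz).1).1
  · filter_upwards [self_mem_nhdsWithin] with z hz
    exact tendsto_expSymbol (openSector_subset hδ.le hz).1
  · filter_upwards [self_mem_nhdsWithin] with z hz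
    obtain ⟨h1, h2⟩ := openSector_subset hδ.le hz
    refine (norm_multiplier_expSymbol_le e hK h1).trans ?_
    gcongr
    · rw [div_le_iff₀ h1, inv_mul_eq_div, le_div_iff₀ hcos, mul_comm]
      exact h2
    · exact Real.exp_le_one_iff.2 (by linarith)
  · intro n
    have : Continuous fun z : ℂ => expSymbol z n := by unfold expSymbol; fun_prop
    have h := this.tendsto 0
    simp only [expSymbol, mul_zero, Complex.exp_zero] at h
    exact h.mono_left nhdsWithin_le_nhds

lemma ofReal_mem_openSector {δ : ℝ} (h0 : 0 < δ) {t : ℝ} (ht : 0 < t) :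
    (t : ℂ) ∈ openSector δ :=
  ⟨by exact_mod_cast ht.ne', by rwa [Complex.arg_ofReal_of_nonneg ht.le, abs_zero]⟩

/-- The semigroup with `T(t) e_n = e^{-4^n t} e_n`. -/
def SchauderBasis.semigroup : C0Semigroup X where
  op t := if 0 < t then SchauderBasis.multiplier e (expSymbol t) else ContinuousLinearMap.id ℂ X
  op_zero := by simp
  op_add := by
    intro s t hs ht
    rcases hs.eq_or_lt with rfl | hs
    · ext x; simp
    rcases ht.eq_or_lt with rfl | ht
    · ext x; simp
    rw [if_pos (by positivity), if_pos hs, if_pos ht]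
    ext x
    refine SchauderBasis.ext_coord e fun n => ?_
    rw [ContinuousLinearMap.comp_apply, coord_expSymbol (by simpa using add_pos hs ht),
      coord_expSymbol (by simpa using hs), coord_expSymbol (by simpa using ht), Complex.ofReal_add,
      expSymbol_add, mul_assoc]
  tendsto_op := by
    intro x
    have h := tendsto_expSymbol_sector e (δ := Real.pi / 4) (by linarith [Real.pi_pos])
      (by positivity) x
    have h2 : Tendsto (fun t : ℝ => (t : ℂ)) (𝓝[>] 0) (𝓝[openSector (Real.pi / 4)] 0) := by
      refine tendsto_nhdsWithin_iff.2 ⟨?_, ?_⟩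
      · exact (Complex.continuous_ofReal.tendsto' 0 0 (by simp)).mono_left nhdsWithin_le_nhds
      · filter_upwards [self_mem_nhdsWithin] with t ht
        exact ofReal_mem_openSector (by positivity) ht
    refine (h.comp h2).congr' ?_
    filter_upwards [self_mem_nhdsWithin] with t ht
    simp [mem_Ioi.1 ht]

lemma SchauderBasis.semigroup_op {t : ℝ} (ht : 0 < t) :
    (SchauderBasis.semigroup e).op t = SchauderBasis.multiplier e (expSymbol t) := by
  simp [SchauderBasis.semigroup, ht]

lemma SchauderBasis.coord_semigroup {t : ℝ} (ht : 0 ≤ t) (n : ℕ) (x : X) :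
    e.coord n ((SchauderBasis.semigroup e).op t x) = (Real.exp (-4 ^ n * t) : ℝ) * e.coord n x := by
  rcases ht.eq_or_lt with rfl | ht
  · simp [(SchauderBasis.semigroup e).op_zero]
  · rw [SchauderBasis.semigroup_op e ht, coord_expSymbol (by simpa using ht), expSymbol_ofReal]

lemma SchauderBasis.semigroup_basis {t : ℝ} (ht : 0 ≤ t) (n : ℕ) :
    (SchauderBasis.semigroup e).op t (e.basis n) =
      ((Real.exp (-(4 : ℝ) ^ n * t) : ℝ) : ℂ) • e.basis n := by
  refine SchauderBasis.ext_coord e fun k => ?_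
  rw [SchauderBasis.coord_semigroup e ht, map_smul, smul_eq_mul, e.ortho]
  by_cases h : k = n
  · rw [h]
  · simp [h]

lemma SchauderBasis.isExpStable_semigroup : (SchauderBasis.semigroup e).IsExpStable := by
  obtain ⟨K, hK0, hK⟩ := SchauderBasis.exists_pos_norm_proj_le e
  -- The rate `1` is the lowest eigenvalue `4^0`; the maximum with `1` covers `t = 0`, where the
  -- operator is the identity.
  refine ⟨max K 1, 1, one_pos, fun t ht => ?_⟩
  rcases ht.eq_or_lt with rfl | ht
  · rw [(SchauderBasis.semigroup e).op_zero]
    simpa using ContinuousLinearMap.norm_id_le.trans (le_max_right K 1)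
  · rw [SchauderBasis.semigroup_op e ht]
    refine (norm_multiplier_expSymbol_le e hK (by simpa using ht)).trans ?_
    rw [Complex.ofReal_re, Complex.norm_of_nonneg ht.le, div_self ht.ne', one_mul, mul_comm,
      neg_one_mul]
    gcongr
    exact le_max_left _ _

/-- On a half plane `Re w > ε` the Abel series converges uniformly in operator norm, so its sum is
holomorphic by Weierstrass. -/
lemma differentiableAt_multiplier_expSymbol {z : ℂ} (hz : 0 < z.re) :
    DifferentiableAt ℂ (fun z => SchauderBasis.multiplier e (expSymbol z)) z := by
  obtain ⟨K, hK0, hK⟩ := SchauderBasis.exists_pos_norm_proj_le e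
  set ε := z.re / 2
  have hε : 0 < ε := half_pos hz
  set U : Set ℂ := {w | ε < w.re}
  have hU : IsOpen U := isOpen_lt continuous_const Complex.continuous_re
  have hb : ∀ n : ℕ, ∀ w ∈ U, ‖expSymbol w n‖ ≤ 2 / ε ^ 2 * (1 / 4 : ℝ) ^ n := by
    intro n w hw
    rw [norm_expSymbol]
    refine le_trans (Real.exp_le_exp.2 ?_) (exp_neg_four_pow_le hε n)
    rw [neg_mul, neg_mul, neg_le_neg_iff]
    gcongr
    exact (mem_ofPred.1 hw).le
  have hd : DifferentiableOn ℂ (fun w => SchauderBasis.multiplier e (expSymbol w)) U := by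
    refine Complex.differentiableOn_tsum_of_summable_norm
      (u := fun n => (2 / ε ^ 2 * (1 / 4 : ℝ) ^ n + 2 / ε ^ 2 * (1 / 4 : ℝ) ^ (n + 1)) * K)
      ?_ (fun n => ?_) hU fun n w hw => ?_
    · have h := summable_quarter.mul_left (2 / ε ^ 2)
      exact (h.add ((summable_nat_add_iff 1).2 h)).mul_right K
    · refine DifferentiableOn.smul_const ?_ _
      unfold expSymbol
      fun_prop
    · rw [norm_smul]
      gcongr
      · exact (norm_sub_le _ _).trans (add_le_add (hb n w hw) (hb (n + 1) w hw))
      · exact hK _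
  exact hd.differentiableAt (hU.mem_nhds (mem_ofPred.2 (half_lt_self hz)))

lemma SchauderBasis.isBoundedAnalytic_semigroup :
    (SchauderBasis.semigroup e).IsBoundedAnalytic := by
  obtain ⟨K, hK0, hK⟩ := SchauderBasis.exists_pos_norm_proj_le e
  refine ⟨Real.pi / 2, by positivity, le_rfl, fun z => SchauderBasis.multiplier e (expSymbol z),
    fun t ht => (SchauderBasis.semigroup_op e ht).symm, fun z hz w hw => ?_, fun z hz => ?_,
    fun δ h0 hδ => ⟨tendsto_expSymbol_sector e hδ h0, ?_⟩⟩
  · have hz := (openSector_subset le_rfl hz).1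
    have hw := (openSector_subset le_rfl hw).1
    ext x
    refine SchauderBasis.ext_coord e fun n => ?_
    rw [ContinuousLinearMap.comp_apply, coord_expSymbol (by simpa using add_pos hz hw),
      coord_expSymbol hz, coord_expSymbol hw, expSymbol_add, mul_assoc]
  · exact (differentiableAt_multiplier_expSymbol e
      (openSector_subset le_rfl hz).1).differentiableWithinAt
  · have hcos : 0 < Real.cos δ := Real.cos_pos_of_mem_Ioo ⟨by linarith, hδ⟩
    refine ⟨(Real.cos δ)⁻¹ * 1 * K, fun z hz => ?_⟩
    obtain ⟨h1, h2⟩ := openSector_subset hδ.le hz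
    refine (norm_multiplier_expSymbol_le e hK h1).trans ?_
    gcongr
    · rw [div_le_iff₀ h1, inv_mul_eq_div, le_div_iff₀ hcos, mul_comm]
      exact h2
    · exact Real.exp_le_one_iff.2 (by linarith)

end DiagonalSemigroup

/-! ### The generator in coordinates. -/

section Generator

variable {X : Type*} [NormedAddCommGroup X] [NormedSpace ℂ X]

lemma C0Semigroup.tendsto_quot_negGen (T : C0Semigroup X) (y : T.negGen.domain) :
    Tendsto (T.quot y) (𝓝[>] 0) (𝓝 (T.negGen y)) := y.2.choose_spec

lemma C0Semigroup.mem_domain_of_tendsto {T : C0Semigroup X} {x y : X}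
    (h : Tendsto (T.quot x) (𝓝[>] 0) (𝓝 y)) :
    ∃ hx : x ∈ T.negGen.domain, T.negGen ⟨x, hx⟩ = y :=
  ⟨⟨y, h⟩, tendsto_nhds_unique (T.tendsto_quot_negGen ⟨x, ⟨y, h⟩⟩) h⟩

variable [CompleteSpace X] (e : SchauderBasis ℂ X)

lemma tendsto_one_sub_exp_div (a : ℝ) :
    Tendsto (fun t : ℝ => t⁻¹ * (1 - Real.exp (-a * t))) (𝓝[>] 0) (𝓝 a) := by
  have h1 : HasDerivAt (fun t : ℝ => -Real.exp (-a * t)) a 0 := by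
    have := (((hasDerivAt_id (0 : ℝ)).const_mul (-a)).exp).fun_neg
    simpa using this
  have h2 := h1.tendsto_slope.mono_left (nhdsWithin_mono 0 (fun t (ht : 0 < t) => ht.ne'))
  refine h2.congr fun t => ?_
  rw [slope_def_field]
  simp only [mul_zero, Real.exp_zero, sub_zero]
  ring

lemma SchauderBasis.coord_quot (x : X) (n : ℕ) {t : ℝ} (ht : 0 < t) :
    e.coord n ((SchauderBasis.semigroup e).quot x t) =
      ((t⁻¹ * (1 - Real.exp (-4 ^ n * t)) : ℝ) : ℂ) * e.coord n x := by
  rw [C0Semigroup.quot, map_smul, map_sub, SchauderBasis.coord_semigroup e ht.le, smul_eq_mul]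
  push_cast
  ring

lemma SchauderBasis.coord_negGen (y : (SchauderBasis.semigroup e).negGen.domain) (n : ℕ) :
    e.coord n ((SchauderBasis.semigroup e).negGen y) = 4 ^ n * e.coord n (y : X) := by
  have h1 := ((e.coord n).continuous.tendsto _).comp
    ((SchauderBasis.semigroup e).tendsto_quot_negGen y)
  have h2 : Tendsto (fun t : ℝ => ((t⁻¹ * (1 - Real.exp (-4 ^ n * t)) : ℝ) : ℂ) * e.coord n (y : X))
      (𝓝[>] 0) (𝓝 (((4 ^ n : ℝ) : ℂ) * e.coord n (y : X))) :=
    ((Complex.continuous_ofReal.tendsto _).comp (tendsto_one_sub_exp_div (4 ^ n))).mul_const _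
  refine tendsto_nhds_unique h1 ?_
  push_cast at h2 ⊢
  refine h2.congr' ?_
  filter_upwards [self_mem_nhdsWithin] with t ht
  rw [Function.comp_apply, SchauderBasis.coord_quot e _ n ht]
  push_cast
  rfl

/-- The sequence `((1 - e^{-4^n t}) / (4^n t))_n`. -/
def meanSymbol (t : ℝ) (n : ℕ) : ℂ := ((1 - Real.exp (-(4 ^ n * t))) / (4 ^ n * t) : ℝ)

/-- The symbol decreases in `n` from a value at most `1`, so its variation is bounded uniformly in
`t`. -/
lemma summable_meanSymbol {t : ℝ} (ht : 0 < t) :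
    Summable (fun n => ‖meanSymbol t n - meanSymbol t (n + 1)‖) ∧
      ∑' n, ‖meanSymbol t n - meanSymbol t (n + 1)‖ ≤ 1 := by
  set g : ℕ → ℝ := fun n => (1 - Real.exp (-(4 ^ n * t))) / (4 ^ n * t)
  have hg : ∀ n, 0 ≤ g n := fun n => div_nonneg
    (by have : Real.exp (-(4 ^ n * t)) ≤ 1 := Real.exp_le_one_iff.2 (by
          have : 0 < 4 ^ n * t := by positivity
          linarith)
        linarith) (by positivity)
  have h := summable_of_sub_le (m := meanSymbol t) (g := g) (c := 1) zero_le_one hg (fun n => by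
    rw [meanSymbol, meanSymbol, ← Complex.ofReal_sub, Complex.norm_real, Real.norm_of_nonneg,
      one_mul]
    exact sub_nonneg.2 (antitone_one_sub_exp_div (by positivity)
      (mul_le_mul_of_nonneg_right (four_pow_le_succ n) ht.le)))
  refine ⟨h.1, h.2.trans ?_⟩
  rw [one_mul, div_le_one (by positivity)]
  have := Real.add_one_le_exp (-(4 ^ 0 * t))
  linarith

lemma tendsto_meanSymbol {t : ℝ} (ht : 0 < t) : Tendsto (meanSymbol t) atTop (𝓝 0) := by
  refine squeeze_zero_norm (a := fun n => t⁻¹ * (1 / 4 : ℝ) ^ n) (fun n => ?_)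
    (summable_quarter.mul_left _).tendsto_atTop_zero
  have hp : 0 < 4 ^ n * t := by positivity
  have h1 : Real.exp (-(4 ^ n * t)) ≤ 1 := Real.exp_le_one_iff.2 (by linarith)
  rw [meanSymbol, Complex.norm_real, Real.norm_of_nonneg (div_nonneg (by linarith) hp.le),
    div_le_iff₀ hp, one_div, inv_pow]
  have : t⁻¹ * ((4 : ℝ) ^ n)⁻¹ * (4 ^ n * t) = 1 := by field_simp
  rw [this]
  linarith [Real.exp_pos (-(4 ^ n * t))]

/-- The difference quotient of `y` is the multiplier `meanSymbol t` applied to `w`. These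
multipliers are uniformly bounded and their symbols tend to `1`, so the quotient tends to `w`.
Membership in the domain thus reduces to coordinates. -/
lemma SchauderBasis.mem_domain_of_coord {y w : X} (h : ∀ n, e.coord n w = 4 ^ n * e.coord n y) :
    ∃ hy : y ∈ (SchauderBasis.semigroup e).negGen.domain,
      (SchauderBasis.semigroup e).negGen ⟨y, hy⟩ = w := by
  apply C0Semigroup.mem_domain_of_tendsto
  obtain ⟨K, hK0, hK⟩ := SchauderBasis.exists_pos_norm_proj_le e
  have hlim : Tendsto (fun t => SchauderBasis.multiplier e (meanSymbol t) w) (𝓝[>] 0) (𝓝 w) := by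
    refine SchauderBasis.tendsto_multiplier (B := 1 * K) ?_ ?_ ?_ ?_ w
    · filter_upwards [self_mem_nhdsWithin] with t ht
      exact (summable_meanSymbol ht).1
    · filter_upwards [self_mem_nhdsWithin] with t ht
      exact tendsto_meanSymbol ht
    · filter_upwards [self_mem_nhdsWithin] with t ht
      refine (SchauderBasis.norm_multiplier_le hK (summable_meanSymbol ht).1).trans ?_
      gcongr
      exact (summable_meanSymbol ht).2
    · intro n
      have h1 := (tendsto_one_sub_exp_div (4 ^ n)).const_mul ((4 ^ n : ℝ)⁻¹)
      rw [inv_mul_cancel₀ (by positivity)] at h1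
      have h2 := (Complex.continuous_ofReal.tendsto _).comp h1
      rw [Complex.ofReal_one] at h2
      refine h2.congr fun t => ?_
      rw [Function.comp_apply, meanSymbol, ← neg_mul, div_eq_mul_inv, mul_inv]
      congr 1
      ring
  refine hlim.congr' ?_
  filter_upwards [self_mem_nhdsWithin] with t ht
  refine SchauderBasis.ext_coord e fun n => ?_
  have ht' : t ≠ 0 := (mem_Ioi.1 ht).ne'
  rw [SchauderBasis.coord_multiplier (summable_meanSymbol ht).1 (tendsto_meanSymbol ht), h,
    SchauderBasis.coord_quot e _ n ht, meanSymbol, ← neg_mul, ← mul_assoc]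
  congr 1
  have ht'' : (t : ℂ) ≠ 0 := by exact_mod_cast ht'
  push_cast
  field_simp

lemma SchauderBasis.basis_mem_domain (n : ℕ) :
    ∃ hy : e.basis n ∈ (SchauderBasis.semigroup e).negGen.domain,
      (SchauderBasis.semigroup e).negGen ⟨e.basis n, hy⟩ = (4 ^ n : ℂ) • e.basis n := by
  refine SchauderBasis.mem_domain_of_coord e fun k => ?_
  rw [map_smul, smul_eq_mul, e.ortho]
  by_cases h : k = n
  · rw [h]
  · simp [h]

/-- The symbol `4^n e^{-4^n t}` is absolutely summable, hence of bounded variation, and its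
multiplier represents `A T(t)`. -/
lemma SchauderBasis.semigroup_mem_domain (y : X) {t : ℝ} (ht : 0 < t) :
    ∃ hy : (SchauderBasis.semigroup e).op t y ∈ (SchauderBasis.semigroup e).negGen.domain,
      ∀ n, e.coord n ((SchauderBasis.semigroup e).negGen ⟨_, hy⟩) =
        ((4 ^ n * Real.exp (-4 ^ n * t) : ℝ) : ℂ) * e.coord n y := by
  have hs : Summable fun n : ℕ => ((4 ^ n * Real.exp (-4 ^ n * t) : ℝ) : ℂ) := by
    refine Summable.of_norm_bounded (summable_quarter.mul_left (2 / t ^ 2)) fun n => ?_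
    rw [Complex.norm_of_nonneg (by positivity)]
    exact four_pow_mul_exp_le ht n
  have hs' := hs.norm
  have hd : Summable fun n : ℕ => ‖((4 ^ n * Real.exp (-4 ^ n * t) : ℝ) : ℂ) -
      ((4 ^ (n + 1) * Real.exp (-4 ^ (n + 1) * t) : ℝ) : ℂ)‖ :=
    (hs'.add ((summable_nat_add_iff 1).2 hs')).of_nonneg_of_le (fun _ => norm_nonneg _)
      fun _ => norm_sub_le _ _
  have hc := SchauderBasis.coord_multiplier (e := e) hd hs.tendsto_atTop_zero
  obtain ⟨hy, h⟩ := SchauderBasis.mem_domain_of_coord e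
    (y := (SchauderBasis.semigroup e).op t y) (fun n => by
      rw [hc n y, SchauderBasis.coord_semigroup e ht.le]
      push_cast
      ring)
  exact ⟨hy, fun n => by rw [h, hc]⟩

end Generator

/-! ### The observation operator: orbit bounds and the Weiss condition. -/

section Observation

variable {X : Type*} [NormedAddCommGroup X] [NormedSpace ℂ X] (e : SchauderBasis ℂ X)

/-- The functional `∑ (r/4)^n e_n^*`. -/
def SchauderBasis.geomFunctional (r : ℝ) : StrongDual ℂ X :=
  ∑' n, (((r / 4) ^ n : ℝ) : ℂ) • e.coord n

variable {e} in
lemma SchauderBasis.hasSum_geomFunctional {K : ℝ} (hK : ∀ n, ‖e.coord n‖ ≤ K) {r : ℝ} (h0 : 0 ≤ r)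
    (hr : r < 4) (x : X) :
    HasSum (fun n => (((r / 4) ^ n : ℝ) : ℂ) * e.coord n x)
      (SchauderBasis.geomFunctional e r x) := by
  have hs : Summable fun n => (((r / 4) ^ n : ℝ) : ℂ) • e.coord n := by
    refine Summable.of_norm_bounded (((summable_geometric_of_lt_one (r := r / 4) (by positivity)
      (by linarith))).mul_right K) fun n => ?_
    rw [norm_smul, Complex.norm_of_nonneg (by positivity)]
    gcongr
    exact hK n
  have h := (ContinuousLinearMap.apply ℂ ℂ x).hasSum hs.hasSum
  simpa [SchauderBasis.geomFunctional] using h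

variable [CompleteSpace X]

/-- The observation operator with `C e_n = r^n`. -/
def SchauderBasis.observation (r : ℝ) : ObsOperator (SchauderBasis.semigroup e) ℂ where
  map := (SchauderBasis.geomFunctional e r).toLinearMap ∘ₗ (SchauderBasis.semigroup e).negGen.toFun
  bound := ⟨‖SchauderBasis.geomFunctional e r‖, fun _ =>
    ((SchauderBasis.geomFunctional e r).le_opNorm _).trans
      (mul_le_mul_of_nonneg_left (le_add_of_nonneg_left (norm_nonneg _)) (norm_nonneg _))⟩

variable {e} {K : ℝ} (hK : ∀ n, ‖e.coord n‖ ≤ K) {r : ℝ} (h0 : 0 ≤ r) (hr : r < 4)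
include hK h0 hr

/-- `A` multiplies the `n`-th coordinate by `4^n`, which turns the weights `(r/4)^n` of the
functional into `r^n`. -/
lemma SchauderBasis.hasSum_observation (y : (SchauderBasis.semigroup e).negGen.domain) :
    HasSum (fun n => (r : ℂ) ^ n * e.coord n (y : X))
      ((SchauderBasis.observation e r).map y) := by
  have h := SchauderBasis.hasSum_geomFunctional hK h0 hr ((SchauderBasis.semigroup e).negGen y)
  refine h.congr_fun fun n => ?_
  rw [SchauderBasis.coord_negGen, ← mul_assoc]
  push_cast
  rw [← mul_pow, div_mul_cancel₀ _ (by norm_num)]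

lemma SchauderBasis.observation_basis (n : ℕ) :
    ∃ h : e.basis n ∈ (SchauderBasis.semigroup e).negGen.domain,
      (SchauderBasis.observation e r).map ⟨e.basis n, h⟩ = (r : ℂ) ^ n := by
  obtain ⟨h, -⟩ := SchauderBasis.basis_mem_domain e n
  refine ⟨h, (SchauderBasis.hasSum_observation hK h0 hr ⟨_, h⟩).unique ?_⟩
  convert hasSum_single n fun k hk => ?_ using 1
  · simp [e.ortho]
  · simp [e.ortho, hk]

lemma SchauderBasis.hasSum_orbit (x : X) {t : ℝ} (ht : 0 < t) :
    HasSum (fun n => ((r ^ n * Real.exp (-4 ^ n * t) : ℝ) : ℂ) * e.coord n x)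
      ((SchauderBasis.observation e r).orbit x t) := by
  obtain ⟨hy, -⟩ := SchauderBasis.semigroup_mem_domain e x ht
  rw [ObsOperator.orbit, dif_pos hy]
  refine (SchauderBasis.hasSum_observation hK h0 hr ⟨_, hy⟩).congr_fun fun n => ?_
  rw [SchauderBasis.coord_semigroup e ht.le]
  push_cast
  ring

/-- The series converges uniformly on `s > t/2`, since `r^n ≤ 4^n`. -/
lemma SchauderBasis.continuousOn_orbit (x : X) :
    ContinuousOn ((SchauderBasis.observation e r).orbit x) (Ioi 0) := by
  intro t ht
  have ht2 : 0 < t / 2 := half_pos ht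
  have hc : ContinuousOn (fun s : ℝ => ∑' n : ℕ,
      ((r ^ n * Real.exp (-4 ^ n * s) : ℝ) : ℂ) * e.coord n x) (Ioi (t / 2)) := by
    refine continuousOn_tsum
      (u := fun n : ℕ => 2 / (t / 2) ^ 2 * (1 / 4 : ℝ) ^ n * (K * ‖x‖)) (fun n => ?_)
      ((summable_quarter.mul_left _).mul_right _) (fun n s hs => ?_)
    · fun_prop
    · rw [norm_mul, Complex.norm_of_nonneg (by positivity)]
      refine mul_le_mul ?_ ((e.coord n).le_of_opNorm_le (hK n) x) (norm_nonneg _) (by positivity)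
      refine le_trans ?_ (four_pow_mul_exp_le ht2 n)
      gcongr ?_ * Real.exp ?_
      · gcongr
      · rw [neg_mul, neg_mul, neg_le_neg_iff]
        gcongr
        exact (mem_Ioi.1 hs).le
  have hmem : Ioi (t / 2) ∈ 𝓝 t := Ioi_mem_nhds (half_lt_self ht)
  refine (ContinuousAt.congr (hc.continuousAt hmem) ?_).continuousWithinAt
  filter_upwards [hmem] with s hs
  exact (SchauderBasis.hasSum_orbit hK h0 hr x (ht2.trans hs)).tsum_eq

/-- All terms of the orbit series are nonnegative, so a single one bounds the sum from below; for `t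
≤ 4^{-n}` its exponential is at least `e^{-1}`. -/
lemma SchauderBasis.le_norm_orbit {x : X} {ξ : ℕ → ℝ} (hξ : ∀ n, e.coord n x = ξ n)
    (hξ0 : ∀ n, 0 ≤ ξ n) (n : ℕ) {t : ℝ} (ht : 0 < t) (htn : t ≤ (1 / 4) ^ n) :
    r ^ n * (Real.exp (-1) * ξ n) ≤ ‖(SchauderBasis.observation e r).orbit x t‖ := by
  have h := SchauderBasis.hasSum_orbit hK h0 hr x ht
  have h2 := Complex.hasSum_re h
  have h3 : ∀ n, (((r ^ n * Real.exp (-4 ^ n * t) : ℝ) : ℂ) * e.coord n x).re =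
      r ^ n * Real.exp (-4 ^ n * t) * ξ n := fun n => by
    rw [hξ, ← Complex.ofReal_mul, Complex.ofReal_re]
  simp_rw [h3] at h2
  refine le_trans ?_ ((le_hasSum h2 n fun k _ => by have := hξ0 k; positivity).trans
    (Complex.re_le_norm _))
  rw [← mul_assoc]
  refine mul_le_mul_of_nonneg_right ?_ (hξ0 n)
  gcongr
  rw [neg_mul, neg_le_neg_iff]
  calc (4 : ℝ) ^ n * t ≤ 4 ^ n * (1 / 4) ^ n := by gcongr
    _ = 1 := by rw [← mul_pow]; norm_num

omit h0 hr in
-- The inequality `e^{-y} ≤ 1 / (1 + y)` reduces the orbit series to `tsum_two_pow_div_le` with `a =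
-- 1/t`.
lemma SchauderBasis.norm_orbit_le (x : X) {t : ℝ} (ht : 0 < t) :
    ‖(SchauderBasis.observation e 2).orbit x t‖ ≤ 4 * K * ‖x‖ / √t := by
  have h := SchauderBasis.hasSum_orbit hK (r := 2) (by norm_num) (by norm_num) x ht
  obtain ⟨hs, hle⟩ := tsum_two_pow_div_le (inv_pos.2 ht)
  rw [← h.tsum_eq]
  refine (tsum_of_norm_bounded ((hs.hasSum.mul_left t⁻¹).mul_right (K * ‖x‖)) fun n => ?_).trans ?_
  · rw [norm_mul, Complex.norm_of_nonneg (by positivity)]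
    refine mul_le_mul ?_ ((e.coord n).le_of_opNorm_le (hK n) x) (norm_nonneg _) (by positivity)
    have : t⁻¹ * (2 ^ n / (4 ^ n + t⁻¹)) = 2 ^ n * (4 ^ n * t + 1)⁻¹ := by
      field_simp
    rw [this, neg_mul, Real.exp_neg]
    gcongr
    exact Real.add_one_le_exp _
  · have hK0 : 0 ≤ K := (norm_nonneg _).trans (hK 0)
    have hst : √t ≠ 0 := (Real.sqrt_pos.2 ht).ne'
    calc _ ≤ t⁻¹ * (4 / √t⁻¹) * (K * ‖x‖) := by gcongr
      _ = 4 * K * ‖x‖ / √t := by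
        rw [Real.sqrt_inv]
        nth_rw 1 [← Real.mul_self_sqrt ht.le]
        field_simp

omit h0 hr in
lemma SchauderBasis.weiss_observation : (SchauderBasis.observation e 2).Weiss := by
  have hK0 : 0 ≤ K := (norm_nonneg _).trans (hK 0)
  refine ⟨4 * K, fun l hl => ⟨⟨fun y z hyz => ?_, fun w => ?_⟩, fun y => ?_⟩⟩
  · have hl' : ∀ n : ℕ, l + 4 ^ n ≠ 0 := fun n h => by
      have h1 := congrArg Complex.re h
      have h2 : ((4 : ℂ) ^ n).re = 4 ^ n := by
        rw [show (4 : ℂ) ^ n = ((4 ^ n : ℝ) : ℂ) by push_cast; rfl, Complex.ofReal_re]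
      rw [Complex.add_re, h2, Complex.zero_re] at h1
      have : (0 : ℝ) < 4 ^ n := by positivity
      linarith
    refine Subtype.ext (SchauderBasis.ext_coord e fun n => mul_left_cancel₀ (hl' n) ?_)
    have h1 := congrArg (e.coord n) hyz
    simp only [map_add, map_smul, smul_eq_mul, SchauderBasis.coord_negGen] at h1
    linear_combination h1
  -- Surjectivity: the resolvent is the multiplier with symbol `(l + 4^n)⁻¹`, which is absolutely
  -- summable.
  · set m : ℕ → ℂ := fun n => (l + ((4 ^ n : ℝ) : ℂ))⁻¹ with hm
    have hre : ∀ n : ℕ, (4 : ℝ) ^ n ≤ ‖l + ((4 ^ n : ℝ) : ℂ)‖ := fun n => by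
      refine le_trans ?_ (Complex.re_le_norm _)
      rw [Complex.add_re, Complex.ofReal_re]
      linarith
    have hne : ∀ n : ℕ, l + ((4 ^ n : ℝ) : ℂ) ≠ 0 := fun n =>
      norm_pos_iff.1 (lt_of_lt_of_le (by positivity) (hre n))
    have hb : ∀ n, ‖m n‖ ≤ (1 / 4 : ℝ) ^ n := fun n => by
      rw [hm, norm_inv, one_div, inv_pow]
      exact inv_anti₀ (by positivity) (hre n)
    have hms : Summable fun n => ‖m n‖ :=
      summable_quarter.of_nonneg_of_le (fun _ => norm_nonneg _) hb
    have hd : Summable fun n => ‖m n - m (n + 1)‖ :=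
      (hms.add ((summable_nat_add_iff 1).2 hms)).of_nonneg_of_le (fun _ => norm_nonneg _)
        fun _ => norm_sub_le _ _
    have hc := SchauderBasis.coord_multiplier (e := e) hd hms.of_norm.tendsto_atTop_zero
    obtain ⟨hy, h⟩ := SchauderBasis.mem_domain_of_coord e
      (y := SchauderBasis.multiplier e m w) (w := w - l • SchauderBasis.multiplier e m w)
      (fun n => by
        have h1 : m n * (l + ((4 ^ n : ℝ) : ℂ)) = 1 := inv_mul_cancel₀ (hne n)
        push_cast at h1
        rw [map_sub, map_smul, smul_eq_mul, hc]
        linear_combination -(e.coord n w) * h1)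
    exact ⟨⟨_, hy⟩, by simp only [h, add_sub_cancel]⟩
  -- Since `|l + 4^n| ≥ 4^n + Re l`, the coordinates of `y` are at most `K ‖w‖ / (4^n + Re l)`, and
  -- `tsum_two_pow_div_le` applies with `a = Re l`.
  · set w := l • (y : X) + (SchauderBasis.semigroup e).negGen y with hw
    have h := SchauderBasis.hasSum_observation hK (r := 2) (by norm_num) (by norm_num) y
    obtain ⟨hs, hle⟩ := tsum_two_pow_div_le hl
    have hb : ‖(SchauderBasis.observation e 2).map y‖ ≤ 4 / √l.re * (K * ‖w‖) := by
      rw [← h.tsum_eq]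
      refine (tsum_of_norm_bounded (hs.hasSum.mul_right (K * ‖w‖)) fun n => ?_).trans
        (by gcongr)
      have hcw : e.coord n w = (l + ((4 ^ n : ℝ) : ℂ)) * e.coord n (y : X) := by
        rw [hw, map_add, map_smul, smul_eq_mul, SchauderBasis.coord_negGen]
        push_cast
        ring
      have h1 : (4 ^ n + l.re) * ‖e.coord n (y : X)‖ ≤ K * ‖w‖ := by
        refine le_trans ?_ ((e.coord n).le_of_opNorm_le (hK n) w)
        rw [hcw, norm_mul]
        gcongr
        refine le_trans (le_of_eq ?_) (Complex.re_le_norm _)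
        rw [Complex.add_re, Complex.ofReal_re, add_comm]
      rw [norm_mul, norm_pow, Complex.ofReal_ofNat, Complex.norm_ofNat, div_mul_eq_mul_div,
        le_div_iff₀ (by positivity), mul_assoc]
      refine mul_le_mul_of_nonneg_left ?_ (by positivity)
      rwa [mul_comm]
    have hsl : 0 < √l.re := Real.sqrt_pos.2 hl
    calc √l.re * ‖(SchauderBasis.observation e 2).map y‖
        ≤ √l.re * (4 / √l.re * (K * ‖w‖)) := by gcongr
      _ = 4 * K * ‖w‖ := by field_simp

end Observation

/-! ### Upper and lower bounds for Lorentz norms. -/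

section LorentzEstimates

/-- The set where `‖f‖ > α` lies in `(0, (K/α)²)`. -/
lemma eLorentzNorm_top_le {Y : Type*} [NormedAddCommGroup Y] {f : ℝ → Y} {K : ℝ} (hK : 0 ≤ K)
    (hf : ∀ t, 0 < t → ‖f t‖ ≤ K / √t) :
    eLorentzNorm f 2 ⊤ (volume.restrict (Ioi 0)) ≤ ENNReal.ofReal K := by
  rw [eLorentzNorm, if_pos rfl]
  refine iSup₂_le fun α hα => ?_
  have hα' : (0 : ℝ) < α := hα
  have hd : distribFun f (volume.restrict (Ioi 0)) α ≤ ENNReal.ofReal ((K / α) ^ 2) := by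
    rw [distribFun, Measure.restrict_apply' measurableSet_Ioi]
    calc _ ≤ volume (Ioo (0 : ℝ) ((K / α) ^ 2)) := by
          refine measure_mono fun t ht => ?_
          obtain ⟨ht1, ht0⟩ := ht
          have ht0 : 0 < t := ht0
          have h1 : (α : ℝ) < ‖f t‖ := by
            have : (α : ℝ≥0∞) < (‖f t‖₊ : ℝ≥0∞) := ht1
            exact_mod_cast this
          have hs := Real.sqrt_pos.2 ht0
          have h2 := h1.trans_le (hf t ht0)
          rw [lt_div_iff₀ hs] at h2
          refine ⟨ht0, ?_⟩
          rw [← Real.sqrt_lt' (by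
            rcases hK.eq_or_lt with rfl | h
            · nlinarith
            · positivity), lt_div_iff₀ hα']
          linarith
      _ = _ := by rw [Real.volume_Ioo, sub_zero]
  calc (α : ℝ≥0∞) * distribFun f (volume.restrict (Ioi 0)) α ^ (1 / (2 : ℝ))
      ≤ ENNReal.ofReal α * ENNReal.ofReal ((K / α) ^ 2) ^ (1 / (2 : ℝ)) := by
        rw [ENNReal.ofReal_coe_nnreal]
        gcongr
    _ = ENNReal.ofReal K := by
        rw [ENNReal.ofReal_rpow_of_nonneg (by positivity) (by norm_num), ← Real.sqrt_eq_rpow,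
          Real.sqrt_sq (by positivity), ← ENNReal.ofReal_mul hα'.le]
        congr 1
        field_simp

/-- At any level below `c` the superlevel set contains `(0, d)`, whose measure exceeds `t`. -/
lemma le_rearr {Y : Type*} [NormedAddCommGroup Y] {f : ℝ → Y} {τ d c t : ℝ}
    (hdτ : d ≤ τ) (hd0 : 0 < d) (htd : t < d) (hf : ∀ s, 0 < s → s < d → c ≤ ‖f s‖) :
    ENNReal.ofReal c ≤ rearr f (volume.restrict (Ioo 0 τ)) t := by
  refine le_sInf fun s ⟨_, hs⟩ => ?_
  by_contra! hsc
  refine absurd hs (not_le.2 ?_)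
  calc ENNReal.ofReal t < ENNReal.ofReal d := (ENNReal.ofReal_lt_ofReal_iff hd0).2 htd
    _ = volume (Ioo 0 d) := by rw [Real.volume_Ioo, sub_zero]
    _ ≤ _ := by
      rw [distribFun, Measure.restrict_apply' measurableSet_Ioo]
      refine measure_mono fun u hu => ⟨?_, hu.1, hu.2.trans_le hdτ⟩
      refine hsc.trans_le ?_
      rw [← ofReal_norm]
      exact ENNReal.ofReal_le_ofReal (hf u hu.1 hu.2)

/-- For `4^{-(n+1)} < t < 4^{-n}` the rearrangement is at least `2^n b_n`, so `t^{1/2} f^*(t) ≥ b_n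
/ 2`, while the block has `dt/t`-measure at least `3/4`. Summing over the blocks bounds the Lorentz
integral below by a multiple of a tail of `∑ b_n^p`. -/
lemma not_memLorentz_of_not_summable {Y : Type*} [NormedAddCommGroup Y] {f : ℝ → Y} {b : ℕ → ℝ}
    (hb0 : ∀ n, 0 ≤ b n) (hf : ∀ n : ℕ, ∀ t, 0 < t → t ≤ (1 / 4) ^ n → 2 ^ n * b n ≤ ‖f t‖)
    {p : ℝ} (hp : 0 < p) (hb : ¬ Summable fun n => b n ^ p) {τ : ℝ} (hτ : 0 < τ) :
    ¬ MemLorentz f 2 (ENNReal.ofReal p) (volume.restrict (Ioo 0 τ)) := by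
  rintro ⟨-, hlt⟩
  -- Shifting by `N` places `(0, 4^{-(n+N)})` inside `(0, τ)`; the omitted terms do not affect
  -- summability.
  obtain ⟨N, hN⟩ := exists_pow_lt_of_lt_one hτ (show (1 / 4 : ℝ) < 1 by norm_num)
  rw [eLorentzNorm, if_neg ENNReal.ofReal_ne_top, ENNReal.toReal_ofReal hp.le] at hlt
  have hint := (ENNReal.rpow_lt_top_iff_of_pos (by positivity)).1 hlt
  set F : ℝ → ℝ≥0∞ := fun t => (ENNReal.ofReal (t ^ (1 / (2 : ℝ))) *
    rearr f (volume.restrict (Ioo 0 τ)) t) ^ p * ENNReal.ofReal t⁻¹ with hF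
  set I : ℕ → Set ℝ := fun n => Ioo ((1 / 4) ^ (n + N + 1)) ((1 / 4) ^ (n + N))
  have hdisj : Pairwise (Function.onFun Disjoint I) := by
    have key : ∀ i j, i < j → Disjoint (I i) (I j) := fun i j hij => by
      rw [Set.disjoint_left]
      rintro t ⟨h1, _⟩ ⟨_, h4⟩
      have : (1 / 4 : ℝ) ^ (j + N) ≤ (1 / 4) ^ (i + N + 1) :=
        pow_le_pow_of_le_one (by norm_num) (by norm_num) (by omega)
      linarith
    intro i j hij
    rcases lt_or_gt_of_ne hij with h | h
    · exact key i j h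
    · exact (key j i h).symm
  have hI : ∀ n, ENNReal.ofReal (3 / 4 * (1 / 2) ^ p * b (n + N) ^ p) ≤ ∫⁻ t in I n, F t := by
    intro n
    set M := n + N with hM
    have hq : (0 : ℝ) < (1 / 4) ^ M := by positivity
    have hle : ∀ t ∈ I n, ENNReal.ofReal ((b M / 2) ^ p * 4 ^ M) ≤ F t := by
      rintro t ⟨ht1, ht2⟩
      have ht0 : 0 < t := lt_trans (by positivity) ht1
      have hr : ENNReal.ofReal (2 ^ M * b M) ≤ rearr f (volume.restrict (Ioo 0 τ)) t := by
        refine le_rearr (d := (1 / 4) ^ M) ?_ hq ht2 fun s hs0 hs => hf M s hs0 hs.le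
        exact (pow_le_pow_of_le_one (by norm_num) (by norm_num) (by omega)).trans hN.le
      have hsq : (1 / 2 : ℝ) ^ (M + 1) ≤ t ^ (1 / (2 : ℝ)) := by
        rw [← Real.sqrt_eq_rpow]
        refine Real.le_sqrt_of_sq_le ?_
        rw [← pow_mul, mul_comm, pow_mul]
        norm_num at ht1 ⊢
        exact ht1.le
      rw [ENNReal.ofReal_mul (by have := hb0 M; positivity),
        ← ENNReal.ofReal_rpow_of_nonneg (by have := hb0 M; positivity) hp.le, hF]
      refine mul_le_mul' (ENNReal.rpow_le_rpow ?_ hp.le) (ENNReal.ofReal_le_ofReal ?_)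
      · calc ENNReal.ofReal (b M / 2)
            = ENNReal.ofReal ((1 / 2) ^ (M + 1)) * ENNReal.ofReal (2 ^ M * b M) := by
              rw [← ENNReal.ofReal_mul (by positivity)]
              congr 1
              have : (1 / 2 : ℝ) ^ M * 2 ^ M = 1 := by rw [← mul_pow]; norm_num
              rw [pow_succ]
              linear_combination (-b M / 2) * this
          _ ≤ _ := mul_le_mul' (ENNReal.ofReal_le_ofReal hsq) hr
      · rw [show (4 : ℝ) ^ M = ((1 / 4) ^ M)⁻¹ by rw [one_div, inv_pow, inv_inv]]
        exact inv_anti₀ ht0 ht2.le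
    calc ENNReal.ofReal (3 / 4 * (1 / 2) ^ p * b M ^ p)
        = ENNReal.ofReal ((b M / 2) ^ p * 4 ^ M) * volume (I n) := by
          rw [Real.volume_Ioo, ← ENNReal.ofReal_mul (by have := hb0 M; positivity), ← hM,
            show b M / 2 = b M * (1 / 2) by ring, Real.mul_rpow (hb0 M) (by norm_num)]
          congr 1
          have : (1 / 4 : ℝ) ^ M * 4 ^ M = 1 := by rw [← mul_pow]; norm_num
          rw [pow_succ]
          linear_combination (-(3 / 4) * (1 / 2) ^ p * b M ^ p) * this
      _ ≤ _ := (setLIntegral_const _ _).symm.le.trans (setLIntegral_mono' measurableSet_Ioo hle)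
  have hsum : ∑' n, ENNReal.ofReal (3 / 4 * (1 / 2) ^ p * b (n + N) ^ p) < ⊤ := by
    refine lt_of_le_of_lt ?_ hint
    calc _ ≤ ∑' n, ∫⁻ t in I n, F t := ENNReal.tsum_le_tsum hI
      _ = ∫⁻ t in ⋃ n, I n, F t :=
        (lintegral_iUnion (fun n => measurableSet_Ioo) hdisj _).symm
      _ ≤ _ := lintegral_mono_set (iUnion_subset fun n t ht => lt_trans (by positivity) ht.1)
  have hs := ENNReal.summable_toReal hsum.ne
  refine hb ((summable_nat_add_iff N).1 ?_)
  have hs2 : Summable fun n => 3 / 4 * (1 / 2) ^ p * b (n + N) ^ p := by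
    refine hs.congr fun n => ?_
    rw [ENNReal.toReal_ofReal]
    have := hb0 (n + N)
    positivity
  exact (summable_mul_left_iff (by positivity)).1 hs2

end LorentzEstimates

/-! ### Divergence of sums with coefficients of order `n^{-1/q}`. -/

section Coefficients

lemma exists_le_of_tendsto {ξ : ℕ → ℝ} {s c : ℝ} (hc : 0 < c)
    (h : Tendsto (fun n : ℕ => ξ n * (n : ℝ) ^ s) atTop (𝓝 c)) :
    ∃ N : ℕ, 0 < N ∧ ∀ n ≥ N, c / 2 * (n : ℝ) ^ (-s) ≤ ξ n := by
  obtain ⟨N, hN⟩ := eventually_atTop.1 (h.eventually (lt_mem_nhds (half_lt_self hc)))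
  refine ⟨N + 1, Nat.succ_pos N, fun n hn => ?_⟩
  have hn0 : (0 : ℝ) < n := by exact_mod_cast (show 0 < n by omega)
  rw [Real.rpow_neg hn0.le, ← div_eq_mul_inv, div_le_iff₀ (by positivity)]
  exact (hN n (by omega)).le

/-- Comparison with the harmonic series, as `p/q ≤ 1`. -/
lemma not_summable_rpow_of_tendsto {ξ : ℕ → ℝ} {q c a p : ℝ} (hc : 0 < c) (ha : 0 < a) (hq : 0 < q)
    (h : Tendsto (fun n : ℕ => ξ n * (n : ℝ) ^ (1 / q)) atTop (𝓝 c)) (hp : 0 < p) (hpq : p ≤ q) :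
    ¬ Summable fun n => (a * ξ n) ^ p := by
  obtain ⟨N, hN0, hN⟩ := exists_le_of_tendsto hc h
  intro hs
  refine Real.not_summable_natCast_inv ((summable_nat_add_iff N).1 ?_)
  have hs2 := ((summable_nat_add_iff N).2 hs).mul_left ((a * (c / 2)) ^ p)⁻¹
  refine hs2.of_nonneg_of_le (fun n => by positivity) fun n => ?_
  have hn1 : (1 : ℝ) ≤ (n + N : ℕ) := by exact_mod_cast (show 1 ≤ n + N by omega)
  rw [le_inv_mul_iff₀ (by positivity)]
  calc (a * (c / 2)) ^ p * ((n + N : ℕ) : ℝ)⁻¹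
      ≤ (a * (c / 2)) ^ p * (((n + N : ℕ) : ℝ) ^ (-(1 / q))) ^ p := by
        gcongr
        rw [← Real.rpow_mul (by positivity), ← Real.rpow_neg_one]
        refine Real.rpow_le_rpow_of_exponent_le hn1 ?_
        have : p / q ≤ 1 := (div_le_one hq).2 hpq
        have h2 : -(1 / q) * p = -(p / q) := by ring
        linarith
    _ = (a * (c / 2 * ((n + N : ℕ) : ℝ) ^ (-(1 / q)))) ^ p := by
        rw [← Real.mul_rpow (by positivity) (by positivity), mul_assoc]
    _ ≤ _ := by
        gcongr
        exact hN _ (by omega)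

/-- The terms do not tend to zero: Bernoulli gives `(3/2)^n ≥ n/2`, which outweighs `n^{-1/q} ≥
n^{-1}`. -/
lemma not_summable_geom_rpow_of_tendsto {ξ : ℕ → ℝ} {q c a p : ℝ} (hc : 0 < c) (ha : 0 < a)
    (hq : 1 ≤ q) (h : Tendsto (fun n : ℕ => ξ n * (n : ℝ) ^ (1 / q)) atTop (𝓝 c)) (hp : 0 < p) :
    ¬ Summable fun n => ((3 / 2) ^ n * (a * ξ n)) ^ p := by
  obtain ⟨N, hN0, hN⟩ := exists_le_of_tendsto hc h
  intro hs
  have h0 := hs.tendsto_atTop_zero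
  have hpos : 0 < (a * (c / 2) / 2) ^ p := by positivity
  obtain ⟨M, hM⟩ := eventually_atTop.1 (h0.eventually (gt_mem_nhds hpos))
  have hn1 : (1 : ℝ) ≤ (M + N : ℕ) := by exact_mod_cast (show 1 ≤ M + N by omega)
  refine absurd (hM (M + N) (by omega)) (not_lt.2 ?_)
  gcongr
  have hB : ((M + N : ℕ) : ℝ) / 2 ≤ (3 / 2) ^ (M + N) := by
    have := one_add_mul_le_pow (show (-2 : ℝ) ≤ 1 / 2 by norm_num) (M + N)
    norm_num at this ⊢
    linarith
  have hr : ((M + N : ℕ) : ℝ)⁻¹ ≤ ((M + N : ℕ) : ℝ) ^ (-(1 / q)) := by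
    rw [← Real.rpow_neg_one]
    refine Real.rpow_le_rpow_of_exponent_le hn1 ?_
    have : 1 / q ≤ 1 := (div_le_one (by linarith)).2 hq
    linarith
  calc a * (c / 2) / 2
      = ((M + N : ℕ) : ℝ) / 2 * (a * (c / 2 * ((M + N : ℕ) : ℝ)⁻¹)) := by field_simp
    _ ≤ (3 / 2) ^ (M + N) * (a * (c / 2 * ((M + N : ℕ) : ℝ) ^ (-(1 / q)))) := by gcongr
    _ ≤ _ := by
        gcongr
        exact hN _ (by omega)

end Coefficients

/-! ### Sign and asymptotics of the cosine coefficients of `s^{-α}`. -/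

section CosineIntegrals

/-- Leibniz: after the first pair, further pairs and a possible last unpaired term only add. -/
lemma le_sum_alternating {a : ℕ → ℝ} (ha : Antitone a) (h0 : ∀ n, 0 ≤ a n) {k : ℕ} (hk : 1 ≤ k) :
    a 0 - a 1 ≤ ∑ j ∈ Finset.range k, (-1) ^ j * a j := by
  have key : ∀ m : ℕ, a 0 - a 1 ≤ ∑ j ∈ Finset.range (2 * m + 2), (-1) ^ j * a j := by
    intro m
    induction m with
    | zero => simp [Finset.sum_range_succ, sub_eq_add_neg]
    | succ m ih =>
      rw [show 2 * (m + 1) + 2 = 2 * m + 2 + 1 + 1 by ring, Finset.sum_range_succ,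
        Finset.sum_range_succ, show 2 * m + 2 + 1 = 2 * (m + 1) + 1 by ring,
        show 2 * m + 2 = 2 * (m + 1) by ring, Odd.neg_one_pow ⟨m + 1, rfl⟩, Even.neg_one_pow (even_two_mul (m + 1))]
      have := ha (show 2 * (m + 1) ≤ 2 * (m + 1) + 1 by omega)
      rw [show 2 * m + 2 = 2 * (m + 1) by ring] at ih
      linarith
  rcases Nat.even_or_odd' k with ⟨m, rfl | rfl⟩
  · obtain ⟨m, rfl⟩ := Nat.exists_eq_add_of_le' (show 1 ≤ m by omega)
    exact key m
  · rcases m with _ | m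
    · simpa using h0 1
    · rw [show 2 * (m + 1) + 1 = 2 * m + 2 + 1 by ring, Finset.sum_range_succ]
      refine (key m).trans (le_add_of_nonneg_right ?_)
      rw [show 2 * m + 2 = 2 * (m + 1) by ring, pow_mul]
      simpa using h0 _

variable {α : ℝ}

/-- Near `0` the bound `|sin u| ≤ u` leaves `u^{-α}`, integrable as `α < 1`; at infinity `u^{-α-1}`
suffices, as `α > 0`. -/
lemma integrableOn_rpow_mul_sin (h0 : 0 < α) (h1 : α < 1) :
    IntegrableOn (fun u : ℝ => u ^ (-α - 1) * Real.sin u) (Ioi 0) := by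
  have hm : ∀ s : Set ℝ, s ⊆ Ioi 0 → MeasurableSet s → AEStronglyMeasurable
      (fun u : ℝ => u ^ (-α - 1) * Real.sin u) (volume.restrict s) := fun s hs hms => by
    refine ContinuousOn.aestronglyMeasurable (fun u hu => ?_) hms
    exact ((Real.continuousAt_rpow_const u _ (Or.inl (mem_Ioi.1 (hs hu)).ne')).mul
      Real.continuous_sin.continuousAt).continuousWithinAt
  rw [← Ioc_union_Ioi_eq_Ioi zero_le_one]
  refine IntegrableOn.union ?_ ?_
  · have hi : IntegrableOn (fun u : ℝ => u ^ (-α)) (Ioc 0 1) :=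
      (intervalIntegrable_iff_integrableOn_Ioc_of_le zero_le_one).1
        (intervalIntegral.intervalIntegrable_rpow' (by linarith))
    refine hi.mono' (hm _ Ioc_subset_Ioi_self measurableSet_Ioc) ?_
    filter_upwards [ae_restrict_mem measurableSet_Ioc] with u hu
    rw [norm_mul, Real.norm_of_nonneg (Real.rpow_nonneg hu.1.le _), Real.norm_eq_abs]
    calc u ^ (-α - 1) * |Real.sin u| ≤ u ^ (-α - 1) * |u| := by
          gcongr ?_ * ?_
          · exact Real.rpow_nonneg hu.1.le _
          · exact Real.abs_sin_le_abs
      _ = u ^ (-α) := by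
          rw [abs_of_pos hu.1, Real.rpow_sub_one hu.1.ne', div_mul_cancel₀ _ hu.1.ne']
  · have hi : IntegrableOn (fun u : ℝ => u ^ (-α - 1)) (Ioi 1) :=
      integrableOn_Ioi_rpow_of_lt (by linarith) one_pos
    refine hi.mono' (hm _ (Ioi_subset_Ioi zero_le_one) measurableSet_Ioi) ?_
    filter_upwards [ae_restrict_mem measurableSet_Ioi] with u hu
    have hu0 : 0 < u := one_pos.trans hu
    rw [norm_mul, Real.norm_of_nonneg (Real.rpow_nonneg hu0.le _), Real.norm_eq_abs]
    exact mul_le_of_le_one_right (Real.rpow_nonneg hu0.le _) (Real.abs_sin_le_one u)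

lemma intervalIntegrable_rpow_mul_sin (h0 : 0 < α) (h1 : α < 1) {a b : ℝ} (ha : 0 ≤ a)
    (hb : 0 ≤ b) : IntervalIntegrable (fun u : ℝ => u ^ (-α - 1) * Real.sin u) volume a b := by
  rw [intervalIntegrable_iff]
  refine (integrableOn_rpow_mul_sin h0 h1).mono_set ?_
  intro u hu
  exact lt_of_le_of_lt (le_min ha hb) hu.1

/-- The integral `∫_0^{kπ} u^{-α-1} sin u du`. -/
def sinIntegral (α : ℝ) (k : ℕ) : ℝ := ∫ u in (0 : ℝ)..k * Real.pi, u ^ (-α - 1) * Real.sin u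

lemma sinIntegral_eq_sum (h0 : 0 < α) (h1 : α < 1) (k : ℕ) :
    sinIntegral α k = ∑ j ∈ Finset.range k, (-1) ^ j *
      ∫ v in (0 : ℝ)..Real.pi, (v + j * Real.pi) ^ (-α - 1) * Real.sin v := by
  have h := intervalIntegral.sum_integral_adjacent_intervals (n := k) (μ := volume)
    (a := fun j : ℕ => (j : ℝ) * Real.pi) (f := fun u : ℝ => u ^ (-α - 1) * Real.sin u)
    (fun j _ => intervalIntegrable_rpow_mul_sin h0 h1 (by positivity) (by positivity))
  rw [Nat.cast_zero, zero_mul] at h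
  rw [sinIntegral, ← h]
  refine Finset.sum_congr rfl fun j _ => ?_
  have h2 := intervalIntegral.integral_comp_add_right (a := 0) (b := Real.pi)
    (fun u : ℝ => u ^ (-α - 1) * Real.sin u) (j * Real.pi)
  rw [zero_add] at h2
  rw [show ((j + 1 : ℕ) : ℝ) * Real.pi = Real.pi + j * Real.pi by push_cast; ring, ← h2,
    ← intervalIntegral.integral_const_mul]
  refine intervalIntegral.integral_congr fun v _ => ?_
  simp only [Real.sin_add_nat_mul_pi]
  ring

/-- The half-period integrals alternate in sign and decrease in modulus, strictly between the first
two. A bound uniform in `k` is needed so that the limit is positive too. -/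
lemma exists_pos_le_sinIntegral (h0 : 0 < α) (h1 : α < 1) :
    ∃ δ : ℝ, 0 < δ ∧ ∀ k, 1 ≤ k → δ ≤ sinIntegral α k := by
  set a : ℕ → ℝ := fun j =>
    ∫ v in (0 : ℝ)..Real.pi, (v + j * Real.pi) ^ (-α - 1) * Real.sin v with ha
  have hint : ∀ j : ℕ, IntervalIntegrable
      (fun v : ℝ => (v + j * Real.pi) ^ (-α - 1) * Real.sin v) volume 0 Real.pi := by
    intro j
    have h := (intervalIntegrable_rpow_mul_sin h0 h1 (a := j * Real.pi)
      (b := Real.pi + j * Real.pi) (by positivity) (by positivity)).comp_add_right (j * Real.pi)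
    rw [sub_self, add_sub_cancel_right] at h
    refine (h.const_mul ((-1) ^ j)).congr fun v _ => ?_
    simp only [Real.sin_add_nat_mul_pi]
    have : ((-1 : ℝ) ^ j) * (-1) ^ j = 1 := by rw [← mul_pow]; norm_num
    linear_combination ((v + j * Real.pi) ^ (-α - 1) * Real.sin v) * this
  have hnn : ∀ j, 0 ≤ a j := fun j => by
    refine intervalIntegral.integral_nonneg Real.pi_pos.le fun v hv => ?_
    exact mul_nonneg (Real.rpow_nonneg (by have := hv.1; positivity) _)
      (Real.sin_nonneg_of_nonneg_of_le_pi hv.1 hv.2)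
  have hanti : Antitone a := by
    refine antitone_nat_of_succ_le fun j => ?_
    refine intervalIntegral.integral_mono_on_of_le_Ioo Real.pi_pos.le (hint _) (hint _) ?_
    intro v hv
    have hv0 := hv.1
    have hs := Real.sin_pos_of_mem_Ioo hv
    gcongr ?_ * _
    refine Real.rpow_le_rpow_of_nonpos (by positivity) ?_ (by linarith)
    push_cast
    nlinarith [Real.pi_pos]
  refine ⟨a 0 - a 1, ?_, fun k hk => ?_⟩
  · rw [ha]
    simp only
    rw [← intervalIntegral.integral_sub (hint 0) (hint 1)]
    refine intervalIntegral.intervalIntegral_pos_of_pos_on ((hint 0).sub (hint 1)) (fun v hv => ?_)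
      Real.pi_pos
    rw [← sub_mul]
    refine mul_pos (sub_pos.2 ?_) (Real.sin_pos_of_mem_Ioo hv)
    have hv0 := hv.1
    refine Real.rpow_lt_rpow_of_neg (by positivity) ?_ (by linarith)
    push_cast
    linarith [Real.pi_pos]
  · rw [sinIntegral_eq_sum h0 h1]
    exact le_sum_alternating hanti hnn hk

lemma tendsto_sinIntegral (h0 : 0 < α) (h1 : α < 1) :
    ∃ L : ℝ, 0 < L ∧ Tendsto (sinIntegral α) atTop (𝓝 L) := by
  have h := intervalIntegral_tendsto_integral_Ioi 0 (integrableOn_rpow_mul_sin h0 h1)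
    (tendsto_natCast_atTop_atTop.atTop_mul_const Real.pi_pos)
  obtain ⟨δ, hδ, hle⟩ := exists_pos_le_sinIntegral h0 h1
  exact ⟨_, hδ.trans_le (ge_of_tendsto h (eventually_atTop.2 ⟨1, hle⟩)), h⟩

/-- The integral `π⁻¹ ∫_0^π s^{-α} cos (k s) ds`. -/
def cosCoeff (α : ℝ) (k : ℕ) : ℝ :=
  Real.pi⁻¹ * ∫ s in (0 : ℝ)..Real.pi, s ^ (-α) * Real.cos (k * s)

lemma intervalIntegrable_rpow_mul_cos (h1 : α < 1) (k : ℕ) (b : ℝ) :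
    IntervalIntegrable (fun s : ℝ => s ^ (-α) * Real.cos (k * s)) volume 0 b :=
  (intervalIntegral.intervalIntegrable_rpow' (by linarith)).mul_continuousOn (by fun_prop)

lemma integral_rpow_mul_sin (k : ℕ) (hk : 1 ≤ k) :
    ∫ s in (0 : ℝ)..Real.pi, s ^ (-α - 1) * Real.sin (k * s) = (k : ℝ) ^ α * sinIntegral α k := by
  have hk0 : (0 : ℝ) < k := by exact_mod_cast hk
  have h := intervalIntegral.integral_comp_mul_left (a := 0) (b := Real.pi)
    (fun u : ℝ => u ^ (-α - 1) * Real.sin u) hk0.ne'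
  rw [mul_zero, smul_eq_mul, ← sinIntegral] at h
  have h2 : ∫ s in (0 : ℝ)..Real.pi, (k * s) ^ (-α - 1) * Real.sin (k * s) =
      (k : ℝ) ^ (-α - 1) * ∫ s in (0 : ℝ)..Real.pi, s ^ (-α - 1) * Real.sin (k * s) := by
    rw [← intervalIntegral.integral_const_mul]
    refine intervalIntegral.integral_congr fun s hs => ?_
    rw [uIcc_of_le Real.pi_pos.le] at hs
    rw [Real.mul_rpow hk0.le hs.1, mul_assoc]
  rw [h2, Real.rpow_sub_one hk0.ne', Real.rpow_neg hk0.le] at h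
  have hka : (k : ℝ) ^ α ≠ 0 := (Real.rpow_pos_of_pos hk0 _).ne'
  field_simp at h
  exact h

/-- Integration by parts replaces `cos` by an absolutely convergent sine integral, and scaling by
`k` extracts the power. The boundary terms vanish: `sin (kπ) = 0`, and `s^{-α} sin (ks) =
O(s^{1-α})` at `0`. -/
lemma cosCoeff_eq (h0 : 0 < α) (h1 : α < 1) {k : ℕ} (hk : 1 ≤ k) :
    cosCoeff α k = α / Real.pi * (k : ℝ) ^ (α - 1) * sinIntegral α k := by
  have hk0 : (0 : ℝ) < k := by exact_mod_cast hk
  set G : ℝ → ℝ := fun s => s ^ (-α) * Real.sin (k * s) with hG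
  have hi1 := (intervalIntegrable_rpow_mul_cos h1 k Real.pi).const_mul (k : ℝ)
  have hi2 : IntervalIntegrable (fun s : ℝ => s ^ (-α - 1) * Real.sin (k * s)) volume 0 Real.pi := by
    have h := (intervalIntegrable_rpow_mul_sin h0 h1 (a := 0) (b := k * Real.pi) le_rfl
      (by positivity)).comp_mul_left (c := k)
    rw [zero_div, mul_div_cancel_left₀ _ hk0.ne'] at h
    refine (h.const_mul ((k : ℝ) ^ (-α - 1))⁻¹).congr fun s hs => ?_
    rw [uIoc_of_le Real.pi_pos.le] at hs
    rw [Real.mul_rpow hk0.le hs.1.le]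
    have : (k : ℝ) ^ (-α - 1) ≠ 0 := (Real.rpow_pos_of_pos hk0 _).ne'
    field_simp
  have hderiv : ∀ s ∈ Ioo (0 : ℝ) Real.pi, HasDerivAt G
      (k * (s ^ (-α) * Real.cos (k * s)) - α * (s ^ (-α - 1) * Real.sin (k * s))) s := by
    intro s hs
    have d1 := Real.hasDerivAt_rpow_const (x := s) (p := -α) (Or.inl hs.1.ne')
    have d2 := ((hasDerivAt_id s).const_mul (k : ℝ)).sin
    exact (d1.fun_mul d2).congr_deriv (by simp only [id]; ring)
  have hcont : ContinuousOn G (Icc 0 Real.pi) := by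
    intro s hs
    rcases hs.1.eq_or_lt with rfl | hs0
    · have hG0 : G 0 = 0 := by simp [hG]
      rw [ContinuousWithinAt, hG0]
      have hlim : Tendsto (fun s : ℝ => k * s ^ (1 - α)) (𝓝[Icc 0 Real.pi] 0) (𝓝 0) := by
        have hc : ContinuousAt (fun s : ℝ => k * s ^ (1 - α)) 0 :=
          (Real.continuousAt_rpow_const 0 _ (Or.inr (by linarith))).const_mul _
        have := hc.tendsto
        rw [Real.zero_rpow (by linarith), mul_zero] at this
        exact this.mono_left nhdsWithin_le_nhds
      refine squeeze_zero_norm' ?_ hlim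
      filter_upwards [self_mem_nhdsWithin] with s hs
      rcases hs.1.eq_or_lt with rfl | hs0
      · rw [hG0, norm_zero]
        positivity
      · rw [hG, norm_mul, Real.norm_of_nonneg (Real.rpow_nonneg hs.1 _), Real.norm_eq_abs]
        calc s ^ (-α) * |Real.sin (k * s)| ≤ s ^ (-α) * |k * s| :=
              mul_le_mul_of_nonneg_left Real.abs_sin_le_abs (Real.rpow_nonneg hs.1 _)
          _ = k * s ^ (1 - α) := by
              rw [abs_of_pos (by positivity), sub_eq_neg_add, Real.rpow_add_one hs0.ne']
              ring
    · exact ((Real.continuousAt_rpow_const s _ (Or.inl hs0.ne')).mul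
        (by fun_prop)).continuousWithinAt
  have hFTC := intervalIntegral.integral_eq_sub_of_hasDerivAt_of_le Real.pi_pos.le hcont hderiv
    (hi1.sub (hi2.const_mul α))
  rw [intervalIntegral.integral_sub hi1 (hi2.const_mul α), intervalIntegral.integral_const_mul,
    intervalIntegral.integral_const_mul, integral_rpow_mul_sin k hk] at hFTC
  simp only [hG, Real.sin_nat_mul_pi, mul_zero, Real.sin_zero, sub_zero] at hFTC
  rw [cosCoeff, Real.rpow_sub_one hk0.ne']
  field_simp
  linarith

lemma cosCoeff_nonneg (h0 : 0 < α) (h1 : α < 1) (k : ℕ) : 0 ≤ cosCoeff α k := by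
  rcases Nat.eq_zero_or_pos k with rfl | hk
  · refine mul_nonneg (by positivity) (intervalIntegral.integral_nonneg Real.pi_pos.le ?_)
    intro s hs
    simpa using Real.rpow_nonneg hs.1 _
  · obtain ⟨δ, hδ, hle⟩ := exists_pos_le_sinIntegral h0 h1
    rw [cosCoeff_eq h0 h1 hk]
    have := hδ.le.trans (hle k hk)
    positivity

lemma natAbs_freq (n : ℕ) : (freq n).natAbs = (n + 1) / 2 := by
  rw [freq]
  split_ifs with h
  · obtain ⟨m, rfl⟩ := h
    rw [Int.natAbs_natCast]
    omega
  · rw [Int.natAbs_neg, Int.natAbs_natCast]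

lemma freq_injective : Function.Injective freq := by
  intro m n h
  simp only [freq, Nat.even_iff] at h
  split_ifs at h <;> omega

lemma tendsto_natCast_div_half :
    Tendsto (fun n : ℕ => (n : ℝ) / ((n + 1) / 2 : ℕ)) atTop (𝓝 2) := by
  have hk : Tendsto (fun n : ℕ => (n + 1) / 2) atTop atTop :=
    tendsto_atTop.2 fun b => eventually_atTop.2 ⟨2 * b, fun n hn => by omega⟩
  have hl : Tendsto (fun n : ℕ => 2 - (((n + 1) / 2 : ℕ) : ℝ)⁻¹) atTop (𝓝 (2 - 0)) :=
    tendsto_const_nhds.sub (tendsto_inv_atTop_zero.comp (tendsto_natCast_atTop_atTop.comp hk))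
  rw [sub_zero] at hl
  refine tendsto_of_tendsto_of_tendsto_of_le_of_le' hl tendsto_const_nhds ?_ ?_
  · filter_upwards [eventually_ge_atTop 1] with n hn
    have hk0 : (0 : ℝ) < ((n + 1) / 2 : ℕ) := by exact_mod_cast (show 0 < (n + 1) / 2 by omega)
    rw [le_div_iff₀ hk0, sub_mul, inv_mul_cancel₀ hk0.ne', sub_le_iff_le_add]
    exact_mod_cast (show 2 * ((n + 1) / 2) ≤ n + 1 by omega)
  · filter_upwards [eventually_ge_atTop 1] with n hn
    have hk0 : (0 : ℝ) < ((n + 1) / 2 : ℕ) := by exact_mod_cast (show 0 < (n + 1) / 2 by omega)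
    rw [div_le_iff₀ hk0]
    exact_mod_cast (show n ≤ 2 * ((n + 1) / 2) by omega)

lemma tendsto_cosCoeff {q : ℝ} (hq : 1 < q) :
    ∃ c : ℝ, 0 < c ∧ Tendsto (fun n : ℕ => cosCoeff (1 - 1 / q) (freq n).natAbs *
      (n : ℝ) ^ (1 / q)) atTop (𝓝 c) := by
  have hq0 : 0 < q := by linarith
  have h1q : 1 / q < 1 := (div_lt_one hq0).2 hq
  have hα0 : 0 < 1 - 1 / q := by linarith
  have hα1 : 1 - 1 / q < 1 := by have : 0 < 1 / q := by positivity
                                 linarith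
  obtain ⟨L, hL, hlim⟩ := tendsto_sinIntegral hα0 hα1
  have hk : Tendsto (fun n : ℕ => (n + 1) / 2) atTop atTop :=
    tendsto_atTop.2 fun b => eventually_atTop.2 ⟨2 * b, fun n hn => by omega⟩
  -- The `n`-th frequency has modulus `k = (n+1)/2` (rounded down), and `n/k → 2` produces
  -- `2^{1/q}`; the rest is `cosCoeff_eq` with `α = 1 - 1/q`.
  refine ⟨(1 - 1 / q) / Real.pi * 2 ^ (1 / q) * L, by positivity, ?_⟩
  have h := ((tendsto_natCast_div_half.rpow_const (p := 1 / q) (Or.inl two_ne_zero)).const_mul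
    ((1 - 1 / q) / Real.pi)).mul (hlim.comp hk)
  refine h.congr' ?_
  filter_upwards [eventually_ge_atTop 1] with n hn
  have hk0 : (0 : ℝ) < ((n + 1) / 2 : ℕ) := by exact_mod_cast (show 0 < (n + 1) / 2 by omega)
  rw [natAbs_freq, cosCoeff_eq hα0 hα1 (by omega), Real.div_rpow (by positivity) hk0.le,
    show 1 - 1 / q - 1 = -(1 / q) by ring, Real.rpow_neg hk0.le, Function.comp_apply]
  ring

/-- Folding at `0`: the contributions of `s` and `-s` add up to `2 cos (ks)`, which sees only `|k|`.
-/
lemma integral_abs_rpow_mul_exp (h1 : α < 1) (k : ℤ) :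
    ∫ s in (-Real.pi)..Real.pi, ((|s| ^ (-α) : ℝ) : ℂ) * Complex.exp (-(Complex.I * k * s)) =
      ((2 * Real.pi * cosCoeff α k.natAbs : ℝ) : ℂ) := by
  set h : ℝ → ℂ := fun s => ((|s| ^ (-α) : ℝ) : ℂ) * Complex.exp (-(Complex.I * k * s)) with hh
  have hr : IntervalIntegrable (fun s : ℝ => s ^ (-α)) volume 0 Real.pi :=
    intervalIntegral.intervalIntegrable_rpow' (by linarith)
  have hi0 : IntervalIntegrable h volume 0 Real.pi := by
    have hi : IntervalIntegrable (fun s : ℝ => ((s ^ (-α) : ℝ) : ℂ)) volume 0 Real.pi :=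
      ⟨hr.1.ofReal, hr.2.ofReal⟩
    refine (hi.mul_continuousOn (g := fun s : ℝ => Complex.exp (-(Complex.I * k * s)))
      (by fun_prop)).congr fun s hs => ?_
    rw [uIoc_of_le Real.pi_pos.le] at hs
    simp only [hh, abs_of_pos hs.1]
  have hin : IntervalIntegrable (fun s => h (-s)) volume 0 Real.pi := by
    have hi : IntervalIntegrable (fun s : ℝ => ((s ^ (-α) : ℝ) : ℂ)) volume 0 Real.pi :=
      ⟨hr.1.ofReal, hr.2.ofReal⟩
    refine (hi.mul_continuousOn (g := fun s : ℝ => Complex.exp (-(Complex.I * k * (-s : ℝ))))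
      (by fun_prop)).congr fun s hs => ?_
    rw [uIoc_of_le Real.pi_pos.le] at hs
    simp only [hh, abs_neg, abs_of_pos hs.1]
  have hineg : IntervalIntegrable h volume (-Real.pi) 0 := by
    have := (IntervalIntegrable.iff_comp_neg (by simp)).1 hin
    simp only [neg_neg, neg_zero] at this
    exact this.symm
  have hneg : ∫ s in (-Real.pi)..0, h s = ∫ s in (0 : ℝ)..Real.pi, h (-s) := by
    rw [intervalIntegral.integral_comp_neg, neg_zero]
  rw [← intervalIntegral.integral_add_adjacent_intervals hineg hi0, hneg,
    ← intervalIntegral.integral_add hin hi0]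
  have : (2 * Real.pi * cosCoeff α k.natAbs : ℝ) =
      ∫ s in (0 : ℝ)..Real.pi, 2 * (s ^ (-α) * Real.cos (k.natAbs * s)) := by
    rw [cosCoeff, intervalIntegral.integral_const_mul]
    field_simp
  rw [this, ← intervalIntegral.integral_ofReal]
  refine intervalIntegral.integral_congr fun s hs => ?_
  rw [uIcc_of_le Real.pi_pos.le] at hs
  have hcos : Real.cos (k.natAbs * s) = Real.cos (k * s) := by
    rw [Nat.cast_natAbs, Int.cast_abs]
    rcases abs_choice (k : ℝ) with h | h <;> rw [h]
    rw [neg_mul, Real.cos_neg]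
  simp only [hh, hcos, abs_neg, abs_of_nonneg hs.1]
  push_cast
  rw [Complex.cos, show -(Complex.I * k * -(s : ℂ)) = k * s * Complex.I by ring,
    show -(Complex.I * k * (s : ℂ)) = -(k * s) * Complex.I by ring]
  ring

end CosineIntegrals

/-! ### Cauchy–Schwarz and the Schur test. -/

section Schur

variable {Ω : Type*} [MeasurableSpace Ω] {μ : Measure Ω}

lemma sq_lintegral_le_of_sq_le {h u v : Ω → ℝ≥0∞} (hu : AEMeasurable u μ) (hv : AEMeasurable v μ)
    (huv : ∀ᵐ x ∂μ, h x ^ 2 ≤ u x * v x) :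
    (∫⁻ x, h x ∂μ) ^ 2 ≤ (∫⁻ x, u x ∂μ) * ∫⁻ x, v x ∂μ := by
  have hsq : ∀ a : ℝ≥0∞, (a ^ (1 / 2 : ℝ)) ^ (2 : ℝ) = a := fun a => by
    rw [← ENNReal.rpow_mul]; norm_num
  have h1 : ∫⁻ x, h x ∂μ ≤ ∫⁻ x, u x ^ (1 / 2 : ℝ) * v x ^ (1 / 2 : ℝ) ∂μ := by
    refine lintegral_mono_ae ?_
    filter_upwards [huv] with x hx
    rw [← ENNReal.mul_rpow_of_nonneg _ _ (by norm_num), one_div, ENNReal.le_rpow_inv_iff two_pos,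
      ENNReal.rpow_two]
    exact hx
  have h2 := ENNReal.lintegral_mul_le_Lp_mul_Lq μ Real.HolderConjugate.two_two
    (hu.pow_const (1 / 2 : ℝ)) (hv.pow_const (1 / 2 : ℝ))
  simp only [Pi.mul_apply, hsq] at h2
  calc (∫⁻ x, h x ∂μ) ^ 2
      ≤ ((∫⁻ x, u x ∂μ) ^ (1 / 2 : ℝ) * (∫⁻ x, v x ∂μ) ^ (1 / 2 : ℝ)) ^ 2 := by
        gcongr
        exact h1.trans h2
    _ = _ := by
        rw [mul_pow, ← ENNReal.rpow_two, ← ENNReal.rpow_two, hsq, hsq]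

/-- The Schur test with the same weight for rows and columns. -/
theorem schur_test [SFinite μ] {k : Ω → Ω → ℝ≥0∞} {p g : Ω → ℝ≥0∞} {C : ℝ≥0∞}
    (hk : Measurable (Function.uncurry k)) (hp : Measurable p) (hg : Measurable g)
    (hp0 : ∀ᵐ x ∂μ, p x ≠ 0 ∧ p x ≠ ⊤)
    (hrow : ∀ᵐ x ∂μ, ∫⁻ y, k x y * p y ∂μ ≤ C * p x)
    (hcol : ∀ᵐ y ∂μ, ∫⁻ x, k x y * p x ∂μ ≤ C * p y) :
    ∫⁻ x, (∫⁻ y, k x y * g y ∂μ) ^ 2 ∂μ ≤ C ^ 2 * ∫⁻ y, g y ^ 2 ∂μ := by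
  have hkx : ∀ x, Measurable (k x) := fun x => hk.comp measurable_prodMk_left
  have hky : ∀ y, Measurable fun x => k x y := fun y => hk.comp measurable_prodMk_right
  have hw : Measurable fun y => g y ^ 2 / p y := (hg.pow_const 2).div hp
  calc ∫⁻ x, (∫⁻ y, k x y * g y ∂μ) ^ 2 ∂μ
      ≤ ∫⁻ x, C * (p x * ∫⁻ y, k x y * (g y ^ 2 / p y) ∂μ) ∂μ := by
        refine lintegral_mono_ae ?_
        filter_upwards [hrow] with x hx
        -- Write `k g` as the geometric mean of `k p` and `k g² / p`: the row condition bounds the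
        -- first factor, and the column condition enters after Tonelli.
        have h := sq_lintegral_le_of_sq_le (μ := μ) (h := fun y => k x y * g y)
          (u := fun y => k x y * p y) (v := fun y => k x y * (g y ^ 2 / p y))
          ((hkx x).mul hp).aemeasurable ((hkx x).mul hw).aemeasurable (by
            filter_upwards [hp0] with y hy
            refine le_of_eq ?_
            calc (k x y * g y) ^ 2 = k x y * k x y * (g y ^ 2) := by ring
              _ = k x y * k x y * (p y * (g y ^ 2 / p y)) := by
                rw [ENNReal.mul_div_cancel hy.1 hy.2]
              _ = _ := by ring)
        refine h.trans ?_
        rw [← mul_assoc]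
        gcongr
    _ = C * ∫⁻ x, ∫⁻ y, p x * (k x y * (g y ^ 2 / p y)) ∂μ ∂μ := by
        have hm : ∀ x, p x * ∫⁻ y, k x y * (g y ^ 2 / p y) ∂μ =
            ∫⁻ y, p x * (k x y * (g y ^ 2 / p y)) ∂μ := fun x =>
          (lintegral_const_mul _ ((hkx x).mul hw)).symm
        simp_rw [hm]
        refine lintegral_const_mul _ (Measurable.lintegral_prod_right ?_)
        exact (hp.comp measurable_fst).mul (hk.mul (hw.comp measurable_snd))
    _ = C * ∫⁻ y, ∫⁻ x, p x * (k x y * (g y ^ 2 / p y)) ∂μ ∂μ := by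
        rw [lintegral_lintegral_swap]
        exact ((hp.comp measurable_fst).mul (hk.mul (hw.comp measurable_snd))).aemeasurable
    _ = C * ∫⁻ y, (g y ^ 2 / p y) * ∫⁻ x, k x y * p x ∂μ ∂μ := by
        congr 1
        refine lintegral_congr fun y => ?_
        rw [← lintegral_const_mul (g y ^ 2 / p y) (f := fun x => k x y * p x) ((hky y).mul hp)]
        exact lintegral_congr fun x => by ring
    _ ≤ C * ∫⁻ y, C * g y ^ 2 ∂μ := by
        gcongr C * ?_
        refine lintegral_mono_ae ?_
        filter_upwards [hcol, hp0] with y hy hy0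
        calc g y ^ 2 / p y * ∫⁻ x, k x y * p x ∂μ ≤ g y ^ 2 / p y * (C * p y) := by gcongr
          _ = C * (p y * (g y ^ 2 / p y)) := by ring
          _ = C * g y ^ 2 := by rw [ENNReal.mul_div_cancel hy0.1 hy0.2]
    _ = C ^ 2 * ∫⁻ y, g y ^ 2 ∂μ := by
        rw [lintegral_const_mul _ (hg.pow_const 2), ← mul_assoc, sq]

end Schur

/-! ### A kernel that is homogeneous of degree `-1`. -/

section HomogeneousKernel

lemma lintegral_comp_abs {f : ℝ → ℝ≥0∞} (hf : Measurable f) :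
    ∫⁻ x, f |x| = 2 * ∫⁻ x in Ioi 0, f x := by
  have h1 : ∫⁻ x in Ioi 0, f |x| = ∫⁻ x in Ioi 0, f x :=
    setLIntegral_congr_fun measurableSet_Ioi fun x hx => by simp only [abs_of_pos (mem_Ioi.1 hx)]
  have h2 : ∫⁻ x in Iio 0, f |x| = ∫⁻ x in Ioi 0, f x := by
    have := (Measure.measurePreserving_neg (volume : Measure ℝ)).setLIntegral_comp_preimage
      (measurableSet_Ioi (a := (0 : ℝ))) (f := fun x => f |x|) (hf.comp measurable_id.abs)
    rw [h1] at this
    rw [← this]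
    have hs : (Neg.neg ⁻¹' Ioi (0 : ℝ)) = Iio 0 := by ext; simp
    rw [hs]
    simp only [abs_neg]
  rw [← lintegral_add_compl _ (measurableSet_Ioi (a := (0 : ℝ))), h1, compl_Ioi,
    setLIntegral_congr Iio_ae_eq_Iic.symm, h2, two_mul]

/-- Split at `t = a`: `c < 1` gives convergence at `0` and `c + d > 1` at infinity. -/
lemma lintegral_rpow_mul_max_rpow_le {a c d : ℝ} (ha : 0 < a) (hc : c < 1) (hcd : 1 < c + d) :
    ∫⁻ t in Ioi (0 : ℝ), ENNReal.ofReal (t ^ (-c) * max a t ^ (-d)) =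
      ENNReal.ofReal ((1 / (1 - c) + 1 / (c + d - 1)) * a ^ (1 - c - d)) := by
  have h1 : ∫⁻ t in Ioc 0 a, ENNReal.ofReal (t ^ (-c) * max a t ^ (-d)) =
      ENNReal.ofReal (1 / (1 - c) * a ^ (1 - c - d)) := by
    have hi : IntegrableOn (fun t : ℝ => t ^ (-c) * a ^ (-d)) (Ioc 0 a) :=
      ((intervalIntegrable_iff_integrableOn_Ioc_of_le ha.le).1
        (intervalIntegral.intervalIntegrable_rpow' (by linarith))).mul_const _
    have he : ∫⁻ t in Ioc 0 a, ENNReal.ofReal (t ^ (-c) * max a t ^ (-d)) =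
        ∫⁻ t in Ioc 0 a, ENNReal.ofReal (t ^ (-c) * a ^ (-d)) :=
      setLIntegral_congr_fun measurableSet_Ioc fun t ht => by simp only [max_eq_left ht.2]
    rw [he, ← ofReal_integral_eq_lintegral_ofReal hi, integral_mul_const,
      ← intervalIntegral.integral_of_le ha.le, integral_rpow (Or.inl (by linarith)),
      Real.zero_rpow (by linarith), sub_zero]
    · congr 1
      rw [show 1 - c - d = (1 - c) + -d by ring, show -c + 1 = 1 - c by ring,
        Real.rpow_add ha (1 - c) (-d)]
      ring
    · filter_upwards [ae_restrict_mem measurableSet_Ioc] with t ht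
      have := ht.1
      positivity
  have h2 : ∫⁻ t in Ioi a, ENNReal.ofReal (t ^ (-c) * max a t ^ (-d)) =
      ENNReal.ofReal (1 / (c + d - 1) * a ^ (1 - c - d)) := by
    have hi : IntegrableOn (fun t : ℝ => t ^ (-(c + d))) (Ioi a) :=
      integrableOn_Ioi_rpow_of_lt (by linarith) ha
    have he : ∫⁻ t in Ioi a, ENNReal.ofReal (t ^ (-c) * max a t ^ (-d)) =
        ∫⁻ t in Ioi a, ENNReal.ofReal (t ^ (-(c + d))) :=
      setLIntegral_congr_fun measurableSet_Ioi fun t ht => by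
        simp only [max_eq_right (mem_Ioi.1 ht).le]
        rw [← Real.rpow_add (ha.trans ht), neg_add]
    rw [he, ← ofReal_integral_eq_lintegral_ofReal hi, integral_Ioi_rpow_of_lt (by linarith) ha]
    · congr 1
      have : c + d - 1 ≠ 0 := by linarith
      rw [show -(c + d) + 1 = 1 - c - d by ring, show 1 - c - d = -(c + d - 1) by ring,
        neg_div_neg_eq]
      field_simp
    · filter_upwards [ae_restrict_mem measurableSet_Ioi] with t ht
      have := ha.trans ht
      positivity
  rw [← Ioc_union_Ioi_eq_Ioi ha.le, lintegral_union measurableSet_Ioi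
    (Set.disjoint_left.2 fun t h1 h2 => not_lt.2 h1.2 h2), h1, h2, ← ENNReal.ofReal_add, add_mul]
  · have : 0 < 1 - c := by linarith
    positivity
  · have : 0 < c + d - 1 := by linarith
    positivity

/-- The kernel `|t|^{-β} max(|s|, |t|)^{β-1}`. -/
def maxKernel (β s t : ℝ) : ℝ := |t| ^ (-β) * max |s| |t| ^ (-(1 - β))

lemma maxKernel_nonneg (β s t : ℝ) : 0 ≤ maxKernel β s t := by
  unfold maxKernel
  positivity

lemma measurable_maxKernel (β : ℝ) : Measurable (Function.uncurry (maxKernel β)) := by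
  unfold maxKernel Function.uncurry
  fun_prop

/-- By homogeneity the kernel maps the weight `|t|^{-1/2}` to a multiple of itself in either
variable, and both constants are finite because `β < 1/2`. Integrating over the whole line makes `C`
independent of `E`. -/
lemma exists_schur_maxKernel {β : ℝ} (h1 : β < 1 / 2) :
    ∃ C : ℝ≥0∞, C ≠ ⊤ ∧ ∀ (E : Set ℝ) (g : ℝ → ℝ≥0∞), Measurable g →
      ∫⁻ s in E, (∫⁻ t in E, ENNReal.ofReal (maxKernel β s t) * g t) ^ 2 ≤
        C ^ 2 * ∫⁻ t in E, g t ^ 2 := by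
  -- The constants of `lintegral_rpow_mul_max_rpow_le` for `d = 1 - β`, with `c = β + 1/2` for rows
  -- (`A`) and `c = 1/2` for columns (`B`).
  set A : ℝ := 1 / (1 - (β + 1 / 2)) + 1 / (β + 1 / 2 + (1 - β) - 1)
  set B : ℝ := 1 / (1 - 1 / 2) + 1 / (1 / 2 + (1 - β) - 1)
  have hA : 0 ≤ A := by
    have : 0 < 1 - (β + 1 / 2) := by linarith
    have : 0 < β + 1 / 2 + (1 - β) - 1 := by linarith
    positivity
  have hB : 0 ≤ B := by
    have : 0 < 1 / 2 + (1 - β) - 1 := by linarith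
    positivity
  set D : ℝ := max A B
  refine ⟨2 * ENNReal.ofReal D, by finiteness, fun E g hg => ?_⟩
  have hne : ∀ᵐ x ∂(volume.restrict E : Measure ℝ), x ≠ 0 :=
    ae_restrict_of_ae (Measure.ae_ne volume 0)
  refine schur_test (p := fun t => ENNReal.ofReal (|t| ^ (-(1 / 2) : ℝ)))
    (measurable_maxKernel β).ennreal_ofReal (by fun_prop) hg ?_ ?_ ?_
  · filter_upwards [hne] with x hx
    have := abs_pos.2 hx
    exact ⟨(ENNReal.ofReal_pos.2 (by positivity)).ne', ENNReal.ofReal_ne_top⟩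
  · filter_upwards [hne] with s hs
    have hs' := abs_pos.2 hs
    calc _ ≤ ∫⁻ t, ENNReal.ofReal (maxKernel β s t) * ENNReal.ofReal (|t| ^ (-(1 / 2) : ℝ)) :=
          setLIntegral_le_lintegral _ _
      _ = ∫⁻ t, ENNReal.ofReal (|t| ^ (-(β + 1 / 2)) * max |s| |t| ^ (-(1 - β))) := by
          refine lintegral_congr_ae ?_
          filter_upwards [Measure.ae_ne volume (0 : ℝ)] with t ht
          have ht' := abs_pos.2 ht
          rw [← ENNReal.ofReal_mul (maxKernel_nonneg _ _ _), maxKernel, neg_add,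
            Real.rpow_add ht']
          congr 1
          ring
      _ = 2 * ENNReal.ofReal (A * |s| ^ (-(1 / 2) : ℝ)) := by
          rw [lintegral_comp_abs
            (f := fun t => ENNReal.ofReal (t ^ (-(β + 1 / 2)) * max |s| t ^ (-(1 - β))))
            (by fun_prop), lintegral_rpow_mul_max_rpow_le hs' (by linarith) (by linarith)]
          congr 4
          ring
      _ ≤ 2 * ENNReal.ofReal (D * |s| ^ (-(1 / 2) : ℝ)) := by
          gcongr
          exact le_max_left _ _
      _ = _ := by rw [ENNReal.ofReal_mul (hA.trans (le_max_left _ _)), mul_assoc]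
  · filter_upwards [hne] with t ht
    have ht' := abs_pos.2 ht
    calc _ ≤ ∫⁻ s, ENNReal.ofReal (maxKernel β s t) * ENNReal.ofReal (|s| ^ (-(1 / 2) : ℝ)) :=
          setLIntegral_le_lintegral _ _
      _ = ∫⁻ s, ENNReal.ofReal (|t| ^ (-β)) *
            ENNReal.ofReal (|s| ^ (-(1 / 2) : ℝ) * max |t| |s| ^ (-(1 - β))) := by
          refine lintegral_congr fun s => ?_
          rw [← ENNReal.ofReal_mul (maxKernel_nonneg _ _ _), ← ENNReal.ofReal_mul (by positivity),
            maxKernel, max_comm]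
          congr 1
          ring
      _ = ENNReal.ofReal (|t| ^ (-β)) * (2 * ENNReal.ofReal (B * |t| ^ (1 - 1 / 2 - (1 - β)))) := by
          rw [lintegral_const_mul _ (by fun_prop), lintegral_comp_abs
            (f := fun s => ENNReal.ofReal (s ^ (-(1 / 2) : ℝ) * max |t| s ^ (-(1 - β))))
            (by fun_prop), lintegral_rpow_mul_max_rpow_le ht' (by norm_num) (by linarith)]
      _ = 2 * ENNReal.ofReal (B * |t| ^ (-(1 / 2) : ℝ)) := by
          rw [mul_left_comm, ← ENNReal.ofReal_mul (by positivity), mul_left_comm,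
            ← Real.rpow_add ht']
          congr 4
          ring
      _ ≤ 2 * ENNReal.ofReal (D * |t| ^ (-(1 / 2) : ℝ)) := by
          gcongr
          exact le_max_right _ _
      _ = _ := by rw [ENNReal.ofReal_mul (hA.trans (le_max_left _ _)), mul_assoc]

/-- For `b ≤ a` with `a > 0`, use `b/a ≤ (b/a)^β` and multiply by `a^β`. -/
lemma abs_rpow_sub_rpow_le {a b β : ℝ} (ha : 0 ≤ a) (hb : 0 ≤ b) (h0 : 0 ≤ β) (h1 : β ≤ 1) :
    |a ^ β - b ^ β| ≤ |a - b| * max a b ^ (-(1 - β)) := by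
  wlog hab : b ≤ a generalizing a b
  · rw [abs_sub_comm, abs_sub_comm a b, max_comm]
    exact this hb ha (le_of_not_ge hab)
  rcases ha.eq_or_lt with rfl | ha
  · obtain rfl := le_antisymm hab hb
    simp
  rw [max_eq_left hab, abs_of_nonneg (sub_nonneg.2 hab),
    abs_of_nonneg (sub_nonneg.2 (Real.rpow_le_rpow hb hab h0))]
  have h2 : b / a ≤ (b / a) ^ β := Real.self_le_rpow_of_le_one (by positivity)
    ((div_le_one ha).2 hab) h1
  rw [Real.div_rpow hb ha.le, div_le_div_iff₀ ha (by positivity)] at h2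
  rw [neg_sub, Real.rpow_sub_one ha.ne', mul_div_assoc', le_div_iff₀ ha]
  linarith

end HomogeneousKernel

/-! ### Dirichlet sums and the weighted kernel difference. -/

section DirichletKernel

/-- The sum of the first `N` of the exponentials `e^{iku}` in the order `0, -1, 1, -2, 2, …`. -/
def dirichletSum (N : ℕ) (u : ℝ) : ℂ :=
  ∑ n ∈ Finset.range N, Complex.exp (Complex.I * (freq n : ℂ) * u)

/-- A geometric sum: the first `N` frequencies fill the integers from `-⌊N/2⌋` to `⌊(N+1)/2⌋ - 1`.
-/
lemma exp_sub_one_mul_dirichletSum (N : ℕ) (u : ℝ) :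
    (Complex.exp (Complex.I * u) - 1) * dirichletSum N u =
      Complex.exp (Complex.I * (((N + 1) / 2 : ℕ) : ℝ) * u) -
        Complex.exp (Complex.I * (-((N / 2 : ℕ) : ℝ) : ℝ) * u) := by
  induction N with
  | zero => simp [dirichletSum]
  | succ N ih =>
    rw [dirichletSum, Finset.sum_range_succ, mul_add, ← dirichletSum, ih, sub_mul, one_mul,
      ← Complex.exp_add]
    rcases Nat.even_or_odd' N with ⟨m, rfl | rfl⟩
    · rw [freq, if_pos (even_two_mul m), show (2 * m + 1) / 2 = m by omega,
        show (2 * m + 1 + 1) / 2 = m + 1 by omega, show 2 * m / 2 = m by omega]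
      push_cast
      ring_nf
    · rw [freq, if_neg (Nat.not_even_iff_odd.2 ⟨m, rfl⟩), show (2 * m + 1 + 1) / 2 = m + 1 by omega,
        show (2 * m + 1 + 1 + 1) / 2 = m + 1 by omega, show (2 * m + 1) / 2 = m by omega]
      push_cast
      ring_nf

lemma norm_dirichletSum_mul_le (N : ℕ) (u : ℝ) : ‖dirichletSum N u‖ * |Real.sin (u / 2)| ≤ 1 := by
  have he : ∀ a : ℝ, ‖Complex.exp (Complex.I * a * u)‖ = 1 := fun a => by
    rw [mul_assoc, ← Complex.ofReal_mul, Complex.norm_exp_I_mul_ofReal]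
  have h := congrArg norm (exp_sub_one_mul_dirichletSum N u)
  rw [norm_mul, Complex.norm_exp_I_mul_ofReal_sub_one, Real.norm_eq_abs, abs_mul, abs_two] at h
  have h2 := norm_sub_le (Complex.exp (Complex.I * (((N + 1) / 2 : ℕ) : ℝ) * u))
    (Complex.exp (Complex.I * (-((N / 2 : ℕ) : ℝ) : ℝ) * u))
  rw [← h, he, he] at h2
  linarith

/-- Passing to absolute values can only increase the cosine of the difference; then Jordan's
inequality applies. In this way `|s| - |t|` compensates the zeros of `sin ((s-t)/2)` at `s - t =
±2π` as well as at `0`. -/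
lemma abs_abs_sub_abs_le_sin {s t : ℝ} (hs : |s| ≤ Real.pi) (ht : |t| ≤ Real.pi) :
    |(|s| - |t|)| ≤ Real.pi * |Real.sin ((s - t) / 2)| := by
  have hcos : Real.cos (s - t) ≤ Real.cos (|s| - |t|) := by
    rw [Real.cos_sub, Real.cos_sub, Real.cos_abs, Real.cos_abs,
      ← Real.abs_sin_eq_sin_abs_of_abs_le_pi hs, ← Real.abs_sin_eq_sin_abs_of_abs_le_pi ht,
      ← abs_mul]
    gcongr
    exact le_abs_self _
  have hsq : |Real.sin ((|s| - |t|) / 2)| ≤ |Real.sin ((s - t) / 2)| := by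
    rw [← sq_le_sq, Real.sin_sq_eq_half_sub, Real.sin_sq_eq_half_sub,
      mul_div_cancel₀ _ two_ne_zero, mul_div_cancel₀ _ two_ne_zero]
    linarith
  have hle : |(|s| - |t|) / 2| ≤ Real.pi / 2 := by
    rw [abs_div, abs_two]
    gcongr
    rw [abs_le]
    constructor <;> linarith [abs_nonneg s, abs_nonneg t]
  have h := (Real.mul_abs_le_abs_sin hle).trans hsq
  rw [abs_div, abs_two, div_mul_div_comm, mul_comm 2, mul_div_mul_right _ _ two_ne_zero,
    div_le_iff₀ Real.pi_pos] at h
  linarith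

/-- The weight difference contains the factor `|s| - |t|`, which cancels the singularity of the
Dirichlet kernel; the bound is uniform in `N`. -/
lemma norm_weighted_dirichletSum_sub_le {β s t : ℝ} (h0 : 0 ≤ β) (h1 : β ≤ 1) (ht0 : t ≠ 0)
    (hs : |s| ≤ Real.pi) (ht : |t| ≤ Real.pi) (N : ℕ) :
    ‖((|s| ^ β * |t| ^ (-β) - 1 : ℝ) : ℂ) * dirichletSum N (s - t)‖ ≤
      Real.pi * maxKernel β s t := by
  have ht' := abs_pos.2 ht0
  have e1 : |s| ^ β * |t| ^ (-β) - 1 = |t| ^ (-β) * (|s| ^ β - |t| ^ β) := by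
    rw [mul_sub, ← Real.rpow_add ht', neg_add_cancel, Real.rpow_zero, mul_comm]
  have e2 := abs_rpow_sub_rpow_le (abs_nonneg s) (abs_nonneg t) h0 h1
  have e3 : |(|s| - |t|)| * ‖dirichletSum N (s - t)‖ ≤ Real.pi := by
    calc _ ≤ Real.pi * |Real.sin ((s - t) / 2)| * ‖dirichletSum N (s - t)‖ := by
          gcongr
          exact abs_abs_sub_abs_le_sin hs ht
      _ = Real.pi * (‖dirichletSum N (s - t)‖ * |Real.sin ((s - t) / 2)|) := by ring
      _ ≤ Real.pi * 1 := by
          gcongr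
          exact norm_dirichletSum_mul_le _ _
      _ = Real.pi := mul_one _
  rw [norm_mul, Complex.norm_real, Real.norm_eq_abs, e1, abs_mul,
    abs_of_nonneg (Real.rpow_nonneg ht'.le _)]
  calc |t| ^ (-β) * |(|s| ^ β - |t| ^ β)| * ‖dirichletSum N (s - t)‖
      ≤ |t| ^ (-β) * (|(|s| - |t|)| * max |s| |t| ^ (-(1 - β))) * ‖dirichletSum N (s - t)‖ := by
        gcongr
    _ = (|(|s| - |t|)| * ‖dirichletSum N (s - t)‖) *
          (|t| ^ (-β) * max |s| |t| ^ (-(1 - β))) := by ring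
    _ ≤ Real.pi * (|t| ^ (-β) * max |s| |t| ^ (-(1 - β))) := by gcongr

end DirichletKernel

/-! ### The weighted exponentials form a Schauder basis. -/

section WeightedExponentials

/-- Lebesgue measure on `(-π, π)`. -/
abbrev volumePi : Measure ℝ := volume.restrict (Ioo (-Real.pi) Real.pi)

lemma ae_volumePi : ∀ᵐ s ∂volumePi, s ≠ 0 ∧ |s| < Real.pi := by
  filter_upwards [ae_restrict_of_ae (Measure.ae_ne volume (0 : ℝ)),
    ae_restrict_mem measurableSet_Ioo] with s h1 h2
  exact ⟨h1, abs_lt.2 h2⟩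

lemma integral_volumePi (f : ℝ → ℂ) :
    ∫ s, f s ∂volumePi = ∫ s in (-Real.pi)..Real.pi, f s := by
  rw [intervalIntegral.integral_of_le (by linarith [Real.pi_pos]), integral_Ioc_eq_integral_Ioo]

lemma measurable_weightedExp (w : ℝ) (n : ℕ) : Measurable (weightedExp w n) := by
  unfold weightedExp
  fun_prop

lemma norm_weightedExp (w : ℝ) (n : ℕ) (s : ℝ) : ‖weightedExp w n s‖ = |s| ^ w := by
  rw [weightedExp, norm_mul, Complex.norm_of_nonneg (by positivity)]
  have : Complex.I * (freq n : ℂ) * (s : ℂ) = Complex.I * ((freq n * s : ℝ) : ℂ) := by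
    push_cast; ring
  rw [this, Complex.norm_exp_I_mul_ofReal, mul_one]

lemma integrable_abs_rpow {w : ℝ} (hw : -1 < w) : Integrable (fun s : ℝ => |s| ^ w) volumePi := by
  have h1 : IntervalIntegrable (fun s : ℝ => |s| ^ w) volume 0 Real.pi := by
    refine (intervalIntegral.intervalIntegrable_rpow' hw).congr fun s hs => ?_
    rw [uIoc_of_le Real.pi_pos.le] at hs
    simp only [abs_of_pos hs.1]
  have h2 : IntervalIntegrable (fun s : ℝ => |s| ^ w) volume (-Real.pi) 0 := by
    have := (IntervalIntegrable.iff_comp_neg (by simp)).1 h1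
    simp only [abs_neg, neg_zero] at this
    exact this.symm
  have h3 := h2.trans h1
  rw [intervalIntegrable_iff_integrableOn_Ioo_of_le (by linarith [Real.pi_pos])] at h3
  exact h3

lemma memLp_weightedExp {w : ℝ} (hw : -(1 / 2) < w) (n : ℕ) :
    MemLp (weightedExp w n) 2 volumePi := by
  rw [memLp_two_iff_integrable_sq_norm (measurable_weightedExp w n).aestronglyMeasurable]
  refine (integrable_abs_rpow (w := w * 2) (by linarith)).congr (ae_of_all _ fun s => ?_)
  simp only [norm_weightedExp]
  rw [Real.rpow_mul (abs_nonneg s), Real.rpow_two]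

open scoped Classical in
/-- The function `weightedExp w n` as an element of `L²(-π, π)`. -/
def weightedExpLp (w : ℝ) (n : ℕ) : L2pi :=
  if h : MemLp (weightedExp w n) 2 volumePi then h.toLp else 0

lemma coeFn_weightedExpLp {w : ℝ} (hw : -(1 / 2) < w) (n : ℕ) :
    (weightedExpLp w n : ℝ → ℂ) =ᵐ[volumePi] weightedExp w n := by
  rw [weightedExpLp, dif_pos (memLp_weightedExp hw n)]
  exact MemLp.coeFn_toLp _

lemma conj_weightedExp (w : ℝ) (n : ℕ) (s : ℝ) :
    (starRingEnd ℂ) (weightedExp w n s) =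
      ((|s| ^ w : ℝ) : ℂ) * Complex.exp (-(Complex.I * (freq n : ℂ) * s)) := by
  rw [weightedExp, map_mul, Complex.conj_ofReal, ← Complex.exp_conj]
  simp

lemma inner_weightedExpLp {w : ℝ} (hw : -(1 / 2) < w) (n : ℕ) (g : L2pi) :
    inner ℂ (weightedExpLp w n) g = ∫ s, (starRingEnd ℂ) (weightedExp w n s) * g s ∂volumePi := by
  rw [L2.inner_def]
  refine integral_congr_ae ?_
  filter_upwards [coeFn_weightedExpLp hw n] with s hs
  rw [hs, RCLike.inner_apply, mul_comm]

lemma integrable_conj_weightedExp_mul {w : ℝ} (hw : -(1 / 2) < w) (n : ℕ) (g : L2pi) :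
    Integrable (fun s => (starRingEnd ℂ) (weightedExp w n s) * g s) volumePi := by
  refine (L2.integrable_inner (𝕜 := ℂ) (weightedExpLp w n) g).congr ?_
  filter_upwards [coeFn_weightedExpLp hw n] with s hs
  rw [hs, RCLike.inner_apply, mul_comm]

lemma integral_exp_int (m : ℤ) :
    ∫ s, Complex.exp (Complex.I * m * s) ∂volumePi = if m = 0 then (2 * Real.pi : ℂ) else 0 := by
  rw [integral_volumePi]
  split_ifs with h
  · simp [h]
    ring
  · have hc : Complex.I * m ≠ 0 := mul_ne_zero Complex.I_ne_zero (by exact_mod_cast h)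
    rw [integral_exp_mul_complex hc, div_eq_zero_iff]
    left
    have h1 : Complex.I * m * (Real.pi : ℂ) =
        Complex.I * m * ((-Real.pi : ℝ) : ℂ) + m * (2 * Real.pi * Complex.I) := by
      push_cast; ring
    rw [h1, Complex.exp_add, Complex.exp_int_mul_two_pi_mul_I, mul_one, sub_self]

/-- Opposite weights cancel, leaving the orthogonality of the exponentials; both factors are in `L²`
because `|w| < 1/2`. -/
lemma inner_weightedExpLp_weightedExpLp {w : ℝ} (hw : |w| < 1 / 2) (i j : ℕ) :
    inner ℂ (weightedExpLp (-w) i) (weightedExpLp w j) = if i = j then (2 * Real.pi : ℂ) else 0 := by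
  obtain ⟨hw1, hw2⟩ := abs_lt.1 hw
  rw [inner_weightedExpLp (by linarith)]
  have : ∫ s, (starRingEnd ℂ) (weightedExp (-w) i s) * weightedExpLp w j s ∂volumePi =
      ∫ s, Complex.exp (Complex.I * ((freq j - freq i : ℤ) : ℂ) * s) ∂volumePi := by
    refine integral_congr_ae ?_
    filter_upwards [coeFn_weightedExpLp hw1 j, ae_volumePi] with s hs hs0
    rw [hs, conj_weightedExp, weightedExp, mul_mul_mul_comm, ← Complex.ofReal_mul,
      ← Real.rpow_add (abs_pos.2 hs0.1), neg_add_cancel, Real.rpow_zero, Complex.ofReal_one, one_mul,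
      ← Complex.exp_add]
    push_cast
    ring_nf
  rw [this, integral_exp_int]
  by_cases h : i = j
  · simp [h]
  · rw [if_neg h, if_neg (fun h' => h (freq_injective (by omega)))]

/-- The functional `g ↦ (2π)⁻¹ ∫ |s|^{-w} e^{-iks} g(s) ds`. -/
def weightedCoord (w : ℝ) (n : ℕ) : StrongDual ℂ L2pi :=
  ((2 * Real.pi : ℂ)⁻¹) • innerSL ℂ (weightedExpLp (-w) n)

lemma weightedCoord_apply (w : ℝ) (n : ℕ) (g : L2pi) :
    weightedCoord w n g = (2 * Real.pi : ℂ)⁻¹ * inner ℂ (weightedExpLp (-w) n) g := rfl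

lemma weightedCoord_weightedExpLp {w : ℝ} (hw : |w| < 1 / 2) (i j : ℕ) :
    weightedCoord w i (weightedExpLp w j) = if i = j then 1 else 0 := by
  rw [weightedCoord_apply, inner_weightedExpLp_weightedExpLp hw]
  split_ifs with h
  · rw [inv_mul_cancel₀]
    exact_mod_cast (by positivity : 2 * Real.pi ≠ 0)
  · rw [mul_zero]

/-- The partial sums of the expansion with respect to `weightedExpLp w`. -/
def weightedPartialSum (w : ℝ) (N : ℕ) (g : L2pi) : L2pi :=
  ∑ n ∈ Finset.range N, weightedCoord w n g • weightedExpLp w n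

lemma weightedExp_mul_conj (w : ℝ) (N : ℕ) (s t : ℝ) :
    ∑ n ∈ Finset.range N, weightedExp w n s * (starRingEnd ℂ) (weightedExp (-w) n t) =
      ((|s| ^ w * |t| ^ (-w) : ℝ) : ℂ) * dirichletSum N (s - t) := by
  rw [dirichletSum, Finset.mul_sum]
  refine Finset.sum_congr rfl fun n _ => ?_
  rw [conj_weightedExp, weightedExp, mul_mul_mul_comm, ← Complex.exp_add]
  push_cast
  ring_nf

lemma integrable_dirichletSum_mul {w : ℝ} (hw : |w| < 1 / 2) (N : ℕ) (g : L2pi) (s : ℝ) :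
    Integrable (fun t => ((|s| ^ w * |t| ^ (-w) : ℝ) : ℂ) * dirichletSum N (s - t) * g t)
      volumePi := by
  obtain ⟨hw1, hw2⟩ := abs_lt.1 hw
  simp_rw [← weightedExp_mul_conj, Finset.sum_mul, mul_assoc]
  exact integrable_finsetSum _ fun n _ =>
    (integrable_conj_weightedExp_mul (by linarith) n g).const_mul _

lemma coeFn_weightedPartialSum {w : ℝ} (hw : |w| < 1 / 2) (N : ℕ) (g : L2pi) :
    (weightedPartialSum w N g : ℝ → ℂ) =ᵐ[volumePi] fun s => (2 * Real.pi : ℂ)⁻¹ *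
      ∫ t, ((|s| ^ w * |t| ^ (-w) : ℝ) : ℂ) * dirichletSum N (s - t) * g t ∂volumePi := by
  obtain ⟨hw1, hw2⟩ := abs_lt.1 hw
  have h1 : (weightedPartialSum w N g : ℝ → ℂ) =ᵐ[volumePi]
      fun s => ∑ n ∈ Finset.range N, weightedCoord w n g * weightedExp w n s := by
    induction N with
    | zero =>
      simp only [weightedPartialSum, Finset.range_zero, Finset.sum_empty]
      exact Lp.coeFn_zero _ _ _
    | succ N ih =>
      have e : weightedPartialSum w (N + 1) g =
          weightedPartialSum w N g + weightedCoord w N g • weightedExpLp w N :=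
        Finset.sum_range_succ _ _
      rw [e]
      filter_upwards [ih, Lp.coeFn_add (weightedPartialSum w N g)
        (weightedCoord w N g • weightedExpLp w N), Lp.coeFn_smul (weightedCoord w N g)
        (weightedExpLp w N), coeFn_weightedExpLp hw1 N] with s i1 i2 i3 i4
      rw [i2, Pi.add_apply, i1, i3, Pi.smul_apply, i4, Finset.sum_range_succ, smul_eq_mul]
  refine h1.trans (Eventually.of_forall fun s => ?_)
  simp only
  simp_rw [← weightedExp_mul_conj, Finset.sum_mul, mul_assoc]
  rw [integral_finsetSum _ fun n _ =>
    (integrable_conj_weightedExp_mul (by linarith) n g).const_mul _, Finset.mul_sum]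
  refine Finset.sum_congr rfl fun n _ => ?_
  rw [integral_const_mul, weightedCoord_apply, inner_weightedExpLp (by linarith)]
  ring

/-- Without weight the normalized exponentials are orthonormal, so this is Bessel's inequality. -/
lemma norm_weightedPartialSum_zero_le (N : ℕ) (g : L2pi) : ‖weightedPartialSum 0 N g‖ ≤ ‖g‖ := by
  set c : ℂ := (((√(2 * Real.pi))⁻¹ : ℝ) : ℂ) with hc
  have hcc : c * c = (2 * Real.pi : ℂ)⁻¹ := by
    rw [hc, ← Complex.ofReal_mul, ← mul_inv, Real.mul_self_sqrt (by positivity)]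
    push_cast
    rfl
  have hconj : (starRingEnd ℂ) c = c := Complex.conj_ofReal _
  have ho : Orthonormal ℂ fun n => c • weightedExpLp 0 n := by
    rw [orthonormal_iff_ite]
    intro i j
    have h := inner_weightedExpLp_weightedExpLp (w := 0) (by norm_num) i j
    rw [neg_zero] at h
    rw [inner_smul_left, inner_smul_right, h, hconj, ← mul_assoc, hcc]
    split_ifs
    · rw [inv_mul_cancel₀]
      exact_mod_cast (by positivity : 2 * Real.pi ≠ 0)
    · rw [mul_zero]
  have hS : weightedPartialSum 0 N g =
      ∑ n ∈ Finset.range N, inner ℂ (c • weightedExpLp 0 n) g • (c • weightedExpLp 0 n) := by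
    refine Finset.sum_congr rfl fun n _ => ?_
    rw [weightedCoord_apply, inner_smul_left, smul_smul, hconj, ← hcc, neg_zero]
    congr 1
    ring
  have h2 : ‖weightedPartialSum 0 N g‖ ^ 2 ≤ ‖g‖ ^ 2 := by
    refine le_trans (le_of_eq ?_) (ho.sum_inner_products_le g (s := Finset.range N))
    rw [@norm_sq_eq_re_inner ℂ, hS, ho.inner_sum, map_sum]
    refine Finset.sum_congr rfl fun n _ => ?_
    rw [RCLike.conj_mul, ← RCLike.ofReal_pow, RCLike.ofReal_re]
  exact (sq_le_sq₀ (norm_nonneg _) (norm_nonneg _)).1 h2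

lemma enorm_sq_eq_lintegral (g : L2pi) : ‖g‖ₑ ^ 2 = ∫⁻ s, ‖g s‖ₑ ^ 2 ∂volumePi := by
  rw [Lp.enorm_def, eLpNorm_eq_lintegral_rpow_enorm_toReal two_ne_zero ENNReal.ofNat_ne_top,
    ENNReal.toReal_ofNat, ← ENNReal.rpow_two, ← ENNReal.rpow_mul]
  simp

/-- The weighted exponentials have uniformly bounded partial sum operators. -/
theorem exists_norm_weightedPartialSum_le {β : ℝ} (h0 : 0 ≤ β) (h1 : β < 1 / 2) :
    ∃ D : ℝ, ∀ N g, ‖weightedPartialSum β N g‖ ≤ D * ‖g‖ := by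
  have hβ : |β| < 1 / 2 := by rwa [abs_of_nonneg h0]
  obtain ⟨C, hC, hschur⟩ := exists_schur_maxKernel h1
  refine ⟨C.toReal + 1, fun N g => ?_⟩
  -- The unweighted partial sum is a contraction, so only the difference needs an estimate; its
  -- kernel is dominated by `maxKernel`, to which the Schur bound applies.
  set d := weightedPartialSum β N g - weightedPartialSum 0 N g with hd
  have hpt : ∀ᵐ s ∂volumePi,
      ‖d s‖ₑ ≤ ∫⁻ t, ENNReal.ofReal (maxKernel β s t) * ‖g t‖ₑ ∂volumePi := by
    filter_upwards [Lp.coeFn_sub (weightedPartialSum β N g) (weightedPartialSum 0 N g),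
      coeFn_weightedPartialSum hβ N g, coeFn_weightedPartialSum (w := 0) (by norm_num) N g,
      ae_volumePi] with s e1 e2 e3 hs
    rw [e1, Pi.sub_apply, e2, e3, ← mul_sub, ← integral_sub (integrable_dirichletSum_mul hβ N g s)
      (integrable_dirichletSum_mul (by norm_num) N g s), ← integral_const_mul]
    refine (enorm_integral_le_lintegral_enorm _).trans (lintegral_mono_ae ?_)
    filter_upwards [ae_volumePi] with t ht
    have hk := norm_weighted_dirichletSum_sub_le h0 (by linarith) ht.1 hs.2.le ht.2.le N
    have hpi : ‖(2 * Real.pi : ℂ)⁻¹‖ = (2 * Real.pi)⁻¹ := by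
      rw [norm_inv, norm_mul, Complex.norm_ofNat, Complex.norm_of_nonneg Real.pi_pos.le]
    rw [← ofReal_norm, ← ofReal_norm, ← ENNReal.ofReal_mul (maxKernel_nonneg _ _ _)]
    refine ENNReal.ofReal_le_ofReal ?_
    rw [← sub_mul, ← sub_mul, ← Complex.ofReal_sub, neg_zero, Real.rpow_zero, Real.rpow_zero,
      mul_one, norm_mul, norm_mul, hpi, ← mul_assoc]
    gcongr
    calc (2 * Real.pi)⁻¹ * ‖((|s| ^ β * |t| ^ (-β) - 1 : ℝ) : ℂ) * dirichletSum N (s - t)‖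
        ≤ (2 * Real.pi)⁻¹ * (Real.pi * maxKernel β s t) := by gcongr
      _ = 1 / 2 * maxKernel β s t := by field_simp
      _ ≤ maxKernel β s t := by linarith [maxKernel_nonneg β s t]
  have hd2 : ‖d‖ₑ ^ 2 ≤ (C * ‖g‖ₑ) ^ 2 := by
    rw [mul_pow, enorm_sq_eq_lintegral, enorm_sq_eq_lintegral g]
    refine le_trans (lintegral_mono_ae ?_)
      (hschur (Ioo (-Real.pi) Real.pi) (fun t => ‖g t‖ₑ) (Lp.stronglyMeasurable g).measurable.enorm)
    filter_upwards [hpt] with s hs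
    gcongr
  have hd1 : ‖d‖ₑ ≤ C * ‖g‖ₑ := (ENNReal.pow_le_pow_left_iff two_ne_zero).1 hd2
  have hd3 : ‖d‖ ≤ C.toReal * ‖g‖ := by
    have := ENNReal.toReal_mono (by finiteness) hd1
    rwa [ENNReal.toReal_mul, toReal_enorm, toReal_enorm] at this
  calc ‖weightedPartialSum β N g‖ = ‖d + weightedPartialSum 0 N g‖ := by rw [hd, sub_add_cancel]
    _ ≤ ‖d‖ + ‖weightedPartialSum 0 N g‖ := norm_add_le _ _
    _ ≤ C.toReal * ‖g‖ + ‖g‖ := add_le_add hd3 (norm_weightedPartialSum_zero_le N g)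
    _ = _ := by ring

lemma freq_surjective : Function.Surjective freq := by
  intro k
  rcases le_or_gt 0 k with h | h
  · refine ⟨2 * k.toNat, ?_⟩
    rw [freq, if_pos (even_two_mul _)]
    omega
  · refine ⟨2 * (-k).toNat - 1, ?_⟩
    rw [freq, if_neg (by rw [Nat.even_iff]; omega)]
    omega

/-- All Fourier coefficients of the `L²` function `|s|^β g` vanish, so it is zero by Parseval, and
the weight is nonzero almost everywhere. -/
lemma eq_zero_of_inner_weightedExpLp {β : ℝ} (h0 : 0 ≤ β) {g : L2pi}
    (h : ∀ n, inner ℂ (weightedExpLp β n) g = 0) : g = 0 := by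
  set f : ℝ → ℂ := fun s => ((|s| ^ β : ℝ) : ℂ) * g s with hf
  have hlt : -Real.pi < Real.pi := by linarith [Real.pi_pos]
  have hmeas : AEStronglyMeasurable f volumePi :=
    ((by fun_prop : Measurable fun s : ℝ => ((|s| ^ β : ℝ) : ℂ))).aestronglyMeasurable.mul
      (Lp.aestronglyMeasurable g)
  have hfL : MemLp f 2 volumePi := by
    refine MemLp.of_le_mul (c := Real.pi ^ β) (Lp.memLp g) hmeas ?_
    filter_upwards [ae_volumePi] with s hs
    rw [hf, norm_mul, Complex.norm_of_nonneg (by positivity)]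
    gcongr
    exact hs.2.le
  have hfL' : MemLp f 2 (volume.restrict (Ioc (-Real.pi) Real.pi)) := by
    rwa [← restrict_Ioo_eq_restrict_Ioc]
  have hcoef : ∀ k : ℤ, fourierCoeffOn hlt f k = 0 := by
    intro k
    obtain ⟨n, rfl⟩ := freq_surjective k
    rw [fourierCoeffOn_eq_integral, ← integral_volumePi]
    have hn := h n
    rw [inner_weightedExpLp (by linarith)] at hn
    rw [smul_eq_zero]
    right
    rw [← hn]
    refine integral_congr_ae (ae_of_all _ fun s => ?_)
    simp only [hf]
    rw [conj_weightedExp, smul_eq_mul, fourier_coe_apply]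
    have : 2 * Real.pi * Complex.I * ((-freq n : ℤ) : ℂ) * s / ((Real.pi - -Real.pi : ℝ) : ℂ) =
        -(Complex.I * (freq n : ℂ) * s) := by
      have hpi : (Real.pi : ℂ) ≠ 0 := by exact_mod_cast Real.pi_ne_zero
      push_cast
      field_simp
      ring
    rw [this]
    ring
  have hs := hasSum_sq_fourierCoeffOn hlt hfL'
  simp only [hcoef, norm_zero, ne_eq, OfNat.ofNat_ne_zero, not_false_eq_true, zero_pow] at hs
  have hz := hs.unique hasSum_zero
  rw [smul_eq_zero, intervalIntegral.integral_of_le hlt.le, integral_Ioc_eq_integral_Ioo] at hz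
  have hz' := hz.resolve_left (inv_ne_zero (by linarith))
  rw [integral_eq_zero_iff_of_nonneg (fun _ => by positivity)
    ((memLp_two_iff_integrable_sq_norm hmeas).1 hfL)] at hz'
  rw [Lp.eq_zero_iff_ae_eq_zero]
  filter_upwards [hz', ae_volumePi] with s hs hs0
  have h1 : f s = 0 := by simpa using hs
  have h2 := abs_pos.2 hs0.1
  exact (mul_eq_zero.1 h1).resolve_left (by exact_mod_cast (Real.rpow_pos_of_pos h2 β).ne')

/-- The partial sums are eventually exact on the span of the system, which is dense; uniform
boundedness extends convergence to the closure. -/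
lemma tendsto_weightedPartialSum {β : ℝ} (h0 : 0 ≤ β) (h1 : β < 1 / 2) (g : L2pi) :
    Tendsto (fun N => weightedPartialSum β N g) atTop (𝓝 g) := by
  have hβ : |β| < 1 / 2 := by rwa [abs_of_nonneg h0]
  obtain ⟨D, hD⟩ := exists_norm_weightedPartialSum_le h0 h1
  have hadd : ∀ N x y, weightedPartialSum β N (x + y) =
      weightedPartialSum β N x + weightedPartialSum β N y := fun N x y => by
    simp only [weightedPartialSum, map_add, add_smul, Finset.sum_add_distrib]
  have hsmul : ∀ N (c : ℂ) x, weightedPartialSum β N (c • x) = c • weightedPartialSum β N x :=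
    fun N c x => by
      simp only [weightedPartialSum, map_smul, smul_eq_mul, mul_smul, Finset.smul_sum]
  set V := Submodule.span ℂ (range (weightedExpLp β)) with hV
  have hdense : V.topologicalClosure = ⊤ := by
    rw [Submodule.topologicalClosure_eq_top_iff, Submodule.eq_bot_iff]
    intro g hg
    refine eq_zero_of_inner_weightedExpLp h0 fun n => ?_
    exact (Submodule.mem_orthogonal _ _).1 hg _ (Submodule.subset_span ⟨n, rfl⟩)
  have hVt : ∀ y ∈ V, Tendsto (fun N => weightedPartialSum β N y) atTop (𝓝 y) := by
    intro y hy
    induction hy using Submodule.span_induction with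
    | mem x hx =>
      obtain ⟨n, rfl⟩ := hx
      refine tendsto_const_nhds.congr' ?_
      filter_upwards [eventually_gt_atTop n] with N hN
      simp [weightedPartialSum, weightedCoord_weightedExpLp hβ, hN]
    | zero => simp [weightedPartialSum]
    | add x y _ _ hx hy => simpa only [hadd] using hx.add hy
    | smul c x _ hx => simpa only [hsmul] using hx.const_smul c
  have hg : g ∈ closure (V : Set L2pi) := by
    rw [← Submodule.topologicalClosure_coe, hdense]
    trivial
  have hD0 : 0 ≤ max D 0 := le_max_right _ _
  have hD' : ∀ N g, ‖weightedPartialSum β N g‖ ≤ max D 0 * ‖g‖ := fun N g =>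
    (hD N g).trans (by gcongr; exact le_max_left _ _)
  generalize max D 0 = B at hD0 hD'
  rw [Metric.tendsto_nhds]
  intro ε hε
  obtain ⟨y, hyV, hy⟩ := Metric.mem_closure_iff.1 hg (ε / (2 * (B + 1))) (by positivity)
  filter_upwards [(hVt y hyV).eventually (Metric.ball_mem_nhds y (half_pos hε))] with N hN
  have hN' : ‖weightedPartialSum β N y - y‖ < ε / 2 := by rwa [← dist_eq_norm]
  rw [dist_eq_norm] at hy ⊢
  have hsplit : weightedPartialSum β N g = weightedPartialSum β N (g - y) +
      weightedPartialSum β N y := by rw [← hadd, sub_add_cancel]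
  calc ‖weightedPartialSum β N g - g‖
      = ‖weightedPartialSum β N (g - y) + (weightedPartialSum β N y - y) + -(g - y)‖ := by
        rw [hsplit]; congr 1; abel
    _ ≤ ‖weightedPartialSum β N (g - y)‖ + ‖weightedPartialSum β N y - y‖ + ‖g - y‖ := by
        rw [← norm_neg (g - y)]
        exact norm_add₃_le
    _ ≤ B * ‖g - y‖ + ‖weightedPartialSum β N y - y‖ + ‖g - y‖ := by
        gcongr
        exact hD' N _
    _ = (B + 1) * ‖g - y‖ + ‖weightedPartialSum β N y - y‖ := by ring
    _ < (B + 1) * (ε / (2 * (B + 1))) + ε / 2 := by gcongr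
    _ = ε := by field_simp; ring

/-- The Schauder basis `|s|^β e^{iks}` of `L²(-π, π)`. -/
def weightedBasis {β : ℝ} (h0 : 0 ≤ β) (h1 : β < 1 / 2) : SchauderBasis ℂ L2pi where
  basis := weightedExpLp β
  coord := weightedCoord β
  ortho i j := by
    rw [weightedCoord_weightedExpLp (by rwa [abs_of_nonneg h0])]
    by_cases h : i = j
    · simp [h]
    · simp [h]
  expansion g := by
    rw [HasSum, SummationFilter.conditional_filter_eq_map_range, tendsto_map'_iff]
    exact tendsto_weightedPartialSum h0 h1 g

lemma norm_weightedExpLp_eq {w : ℝ} (hw : -(1 / 2) < w) (n : ℕ) :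
    ‖weightedExpLp w n‖ = ‖weightedExpLp w 0‖ := by
  rw [Lp.norm_def, Lp.norm_def]
  congr 1
  refine eLpNorm_congr_norm_ae ?_
  filter_upwards [coeFn_weightedExpLp hw n, coeFn_weightedExpLp hw 0] with s h1 h2
  rw [h1, h2, norm_weightedExp, norm_weightedExp]

lemma exists_norm_weightedCoord_le {β : ℝ} (h1 : β < 1 / 2) :
    ∃ K : ℝ, ∀ n, ‖weightedCoord β n‖ ≤ K := by
  refine ⟨‖(2 * Real.pi : ℂ)⁻¹‖ * ‖weightedExpLp (-β) 0‖, fun n => ?_⟩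
  rw [weightedCoord, norm_smul, innerSL_apply_norm, norm_weightedExpLp_eq (by linarith) n]

/-- Here `weightedExpLp (-β) 0` is the initial value `|s|^{-β}`, since `freq 0 = 0`; the dual weight
doubles the exponent to `-2β`. -/
lemma weightedCoord_weightedExpLp_neg {β : ℝ} (h1 : β < 1 / 2) (n : ℕ) :
    weightedCoord β n (weightedExpLp (-β) 0) = (cosCoeff (2 * β) (freq n).natAbs : ℂ) := by
  have h := integral_abs_rpow_mul_exp (α := 2 * β) (by linarith) (freq n)
  rw [← integral_volumePi] at h
  rw [weightedCoord_apply, inner_weightedExpLp (by linarith)]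
  have : ∫ s, (starRingEnd ℂ) (weightedExp (-β) n s) * weightedExpLp (-β) 0 s ∂volumePi =
      ∫ s : ℝ, ((|s| ^ (-(2 * β)) : ℝ) : ℂ) * Complex.exp (-(Complex.I * (freq n : ℂ) * s))
        ∂volumePi := by
    refine integral_congr_ae ?_
    filter_upwards [coeFn_weightedExpLp (w := -β) (by linarith) 0, ae_volumePi] with s hs hs0
    have hf0 : freq 0 = 0 := by simp [freq]
    rw [hs, conj_weightedExp, weightedExp, hf0, Int.cast_zero, mul_zero, zero_mul,
      Complex.exp_zero, mul_one, mul_right_comm, ← Complex.ofReal_mul,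
      ← Real.rpow_add (abs_pos.2 hs0.1)]
    ring_nf
  rw [this, h]
  have hpi : (Real.pi : ℂ) ≠ 0 := by exact_mod_cast Real.pi_ne_zero
  push_cast
  field_simp

end WeightedExponentials

/-! ### Orlicz's theorem and its consequence for coefficients. -/

section Unconditional

variable {H : Type*} [NormedAddCommGroup H] [InnerProductSpace ℂ H]

/-- Choose signs greedily: each new vector gets the sign that makes its real inner product with the
current sum nonnegative. -/
lemma exists_sum_norm_sq_le_norm_sum_sub_sum {ι : Type*} [DecidableEq ι] (v : ι → H)
    (F : Finset ι) : ∃ A B : Finset ι, Disjoint A B ∧ A ∪ B = F ∧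
      ∑ i ∈ F, ‖v i‖ ^ 2 ≤ ‖∑ i ∈ A, v i - ∑ i ∈ B, v i‖ ^ 2 := by
  induction F using Finset.induction_on with
  | empty => exact ⟨∅, ∅, by simp⟩
  | insert a F ha ih =>
    obtain ⟨A, B, hd, rfl, hle⟩ := ih
    obtain ⟨haA, haB⟩ : a ∉ A ∧ a ∉ B := by simpa using ha
    rw [Finset.sum_insert ha]
    set y := ∑ i ∈ A, v i - ∑ i ∈ B, v i with hy
    rcases le_total 0 (RCLike.re (inner ℂ y (v a))) with h | h
    · refine ⟨insert a A, B, Finset.disjoint_insert_left.2 ⟨haB, hd⟩, by simp, ?_⟩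
      have e : ∑ i ∈ insert a A, v i - ∑ i ∈ B, v i = y + v a := by
        rw [Finset.sum_insert haA, hy]; abel
      rw [e, @norm_add_sq ℂ]
      linarith
    · refine ⟨A, insert a B, Finset.disjoint_insert_right.2 ⟨haA, hd⟩, by simp, ?_⟩
      have e : ∑ i ∈ A, v i - ∑ i ∈ insert a B, v i = y - v a := by
        rw [Finset.sum_insert haB, hy]; abel
      rw [e, @norm_sub_sq ℂ]
      linarith

/-- Orlicz: in a Hilbert space, unconditionally convergent series are square summable. -/
theorem summable_norm_sq_of_summable [CompleteSpace H] {ι : Type*} {v : ι → H} (hv : Summable v) :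
    Summable fun i => ‖v i‖ ^ 2 := by
  classical
  -- The Cauchy criterion at radius `1` bounds all finite subsums at once, hence all signed sums.
  obtain ⟨A₀, hA₀⟩ := summable_iff_vanishing.1 hv (Metric.ball 0 1) (Metric.ball_mem_nhds _ one_pos)
  have hA : ∀ A : Finset ι, ‖∑ i ∈ A, v i‖ ≤ ∑ i ∈ A₀, ‖v i‖ + 1 := by
    intro A
    have h1 : ‖∑ i ∈ A \ A₀, v i‖ < 1 := by
      simpa using hA₀ (A \ A₀) Finset.sdiff_disjoint
    rw [← Finset.sum_inter_add_sum_sdiff A A₀]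
    refine (norm_add_le _ _).trans (add_le_add ?_ h1.le)
    refine (norm_sum_le _ _).trans ?_
    exact Finset.sum_le_sum_of_subset_of_nonneg Finset.inter_subset_right
      fun _ _ _ => norm_nonneg _
  refine summable_of_sum_le (c := (2 * (∑ i ∈ A₀, ‖v i‖ + 1)) ^ 2) (fun _ => by positivity)
    fun F => ?_
  obtain ⟨A, B, -, -, hle⟩ := exists_sum_norm_sq_le_norm_sum_sub_sum v F
  refine hle.trans ?_
  gcongr
  exact (norm_sub_le _ _).trans (by linarith [hA A, hA B])

/-- Apply the functional `e.coord n` to the expansion along `u`; a priori only the basis vectors are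
shared. -/
lemma UnconditionalSchauderBasis.coord_eq {X : Type*} [NormedAddCommGroup X] [NormedSpace ℂ X]
    {e : SchauderBasis ℂ X} {u : UnconditionalSchauderBasis ℕ ℂ X} (h : u.basis = e.basis) (n : ℕ)
    (x : X) : u.coord n x = e.coord n x := by
  have h1 := (e.coord n).hasSum (u.expansion x)
  have h2 : ∀ i, e.coord n (u.coord i x • u.basis i) = if i = n then u.coord n x else 0 := by
    intro i
    rw [map_smul, h, e.ortho, smul_eq_mul]
    by_cases hi : i = n
    · subst hi; simp
    · simp [hi, Ne.symm hi]
  simp only [h2] at h1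
  exact (hasSum_ite_eq n (u.coord n x)).unique h1

/-- Orlicz controls `‖ξ_n e_n‖²`, and biorthogonality gives `1 ≤ K ‖e_n‖`. -/
lemma summable_norm_coord_sq [CompleteSpace H] {e : SchauderBasis ℂ H} {u : UnconditionalSchauderBasis ℕ ℂ H}
    (h : u.basis = e.basis) {K : ℝ} (hK : ∀ n, ‖e.coord n‖ ≤ K) (x : H) :
    Summable fun n => ‖e.coord n x‖ ^ 2 := by
  have hs := summable_norm_sq_of_summable (u.expansion x).summable
  refine (hs.mul_left (K ^ 2)).of_nonneg_of_le (fun _ => by positivity) fun n => ?_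
  have h1 : (1 : ℝ) ≤ K * ‖e.basis n‖ := by
    have := (e.coord n).le_of_opNorm_le (hK n) (e.basis n)
    simpa [e.ortho] using this
  rw [h, UnconditionalSchauderBasis.coord_eq h, norm_smul, mul_pow, mul_left_comm, ← mul_pow K]
  exact le_mul_of_one_le_right (by positivity) (one_le_pow₀ h1)

end Unconditional

lemma SchauderBasis.lorentzAdmissible_observation {X : Type*} [NormedAddCommGroup X]
    [NormedSpace ℂ X] [CompleteSpace X] {e : SchauderBasis ℂ X} {K : ℝ}
    (hK : ∀ n, ‖e.coord n‖ ≤ K) :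
    (SchauderBasis.observation e 2).LorentzAdmissible 2 ⊤ (Ioi 0) := by
  have hK0 : 0 ≤ K := (norm_nonneg _).trans (hK 0)
  have hle : ∀ x : X, eLorentzNorm ((SchauderBasis.observation e 2).orbit x) 2 ⊤
      (volume.restrict (Ioi 0)) ≤ (4 * K).toNNReal * ‖x‖ₑ := fun x => by
    refine (eLorentzNorm_top_le (K := 4 * K * ‖x‖) (by positivity) fun t ht =>
      SchauderBasis.norm_orbit_le hK x ht).trans (le_of_eq ?_)
    rw [ENNReal.ofReal_mul (by positivity), ofReal_norm]
    rfl
  refine ⟨(4 * K).toNNReal, fun x => ⟨⟨?_, (hle x).trans_lt (by finiteness)⟩, hle x⟩⟩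
  exact (SchauderBasis.continuousOn_orbit hK (by norm_num) (by norm_num) x).aestronglyMeasurable
    measurableSet_Ioi

end

/-! ### Assembly of the two examples. -/

theorem theorem2p3 :
    -- one system and one orbit that serve all `q < ∞` and all `τ > 0`
    (∃ (H : Type) (_ : NormedAddCommGroup H) (_ : InnerProductSpace ℂ H) (_ : CompleteSpace H)
      (T : C0Semigroup H) (C : ObsOperator T ℂ) (x : H),
      T.IsExpStable ∧ T.IsBoundedAnalytic ∧
      (∀ y : H, ∀ t : ℝ, 0 < t → T.op t y ∈ T.negGen.domain) ∧
      ContinuousOn (C.orbit x) (Ioi 0) ∧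
      ∀ q : ℝ, 1 ≤ q → ∀ τ : ℝ, 0 < τ →
        ¬ MemLorentz (C.orbit x) 2 (ENNReal.ofReal q) (volume.restrict (Ioo 0 τ))) ∧
    -- for each `q < ∞`, the diagonal system with the Weiss condition; here `β = 1 / (2 q')`
    (∀ q : ℝ, 2 < q → ∀ β : ℝ, β = (1 - 1 / q) / 2 →
      ∃ (e : SchauderBasis ℂ L2pi) (T : C0Semigroup L2pi) (C : ObsOperator T ℂ)
        (x : L2pi) (ξ : ℕ → ℝ),
        -- the basis `|s|^β e^{iks}`, which is conditional
        (∀ n : ℕ, (e.basis n : ℝ → ℂ) =ᵐ[volume.restrict (Ioo (-Real.pi) Real.pi)]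
          weightedExp β n) ∧
        (¬ ∃ u : UnconditionalSchauderBasis ℕ ℂ L2pi, u.basis = e.basis) ∧
        -- the semigroup
        T.IsExpStable ∧ T.IsBoundedAnalytic ∧
        (∀ y : L2pi, ∀ t : ℝ, 0 < t → T.op t y ∈ T.negGen.domain) ∧
        (∀ n : ℕ, ∀ t : ℝ, 0 ≤ t →
          T.op t (e.basis n) = ((Real.exp (-(4 : ℝ) ^ n * t) : ℝ) : ℂ) • e.basis n) ∧
        -- the observation operator
        (∀ n : ℕ, ∃ h : e.basis n ∈ T.negGen.domain, C.map ⟨e.basis n, h⟩ = 2 ^ n) ∧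
        C.Weiss ∧ C.LorentzAdmissible 2 ⊤ (Ioi 0) ∧
        -- the initial value and its coefficients
        ((x : ℝ → ℂ) =ᵐ[volume.restrict (Ioo (-Real.pi) Real.pi)]
          fun s => ((|s| ^ (-β) : ℝ) : ℂ)) ∧
        (∀ n : ℕ, e.coord n x = (ξ n : ℂ)) ∧
        (∀ n : ℕ, 0 ≤ ξ n) ∧
        (∃ c : ℝ, 0 < c ∧ Tendsto (fun n : ℕ => ξ n * (n : ℝ) ^ (1 / q)) atTop (𝓝 c)) ∧
        -- the observed orbit
        ∀ p : ℝ, 1 ≤ p → p ≤ q → ∀ τ : ℝ, 0 < τ →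
          ¬ MemLorentz (C.orbit x) 2 (ENNReal.ofReal p) (volume.restrict (Ioo 0 τ))) := by
  have key : ∀ q : ℝ, 2 < q → ∀ β : ℝ, β = (1 - 1 / q) / 2 → 0 ≤ β ∧ β < 1 / 2 ∧
      2 * β = 1 - 1 / q := by
    rintro q hq β rfl
    have h1 : 0 < 1 / q := by positivity
    have h2 : 1 / q < 1 := (div_lt_one (by linarith)).2 (by linarith)
    exact ⟨by linarith, by linarith, by ring⟩
  refine ⟨?_, fun q hq β hβ => ?_⟩
  -- For the first assertion the exponent `3` is just a convenient choice above `2`.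
  · obtain ⟨β, hβ⟩ : ∃ β : ℝ, β = (1 - 1 / 3) / 2 := ⟨_, rfl⟩
    obtain ⟨h0, h1, h2⟩ := key 3 (by norm_num) β hβ
    set e := weightedBasis h0 h1
    obtain ⟨K, hK⟩ : ∃ K : ℝ, ∀ n, ‖e.coord n‖ ≤ K := exists_norm_weightedCoord_le h1
    obtain ⟨c, hc, hlim⟩ := tendsto_cosCoeff (q := 3) (by norm_num)
    rw [← h2] at hlim
    refine ⟨L2pi, inferInstance, inferInstance, inferInstance, SchauderBasis.semigroup e,
      SchauderBasis.observation e 3, weightedExpLp (-β) 0, SchauderBasis.isExpStable_semigroup e,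
      SchauderBasis.isBoundedAnalytic_semigroup e,
      fun y t ht => (SchauderBasis.semigroup_mem_domain e y ht).1,
      SchauderBasis.continuousOn_orbit hK (by norm_num) (by norm_num) _, fun p hp τ hτ => ?_⟩
    have hnn : ∀ n, 0 ≤ cosCoeff (2 * β) (freq n).natAbs := fun n =>
      cosCoeff_nonneg (by rw [h2]; norm_num) (by linarith) _
    -- With `C e_n = 3^n = 2^n (3/2)^n`, the geometric excess over `2^n` makes the sum diverge for
    -- every finite exponent.
    refine not_memLorentz_of_not_summable
      (b := fun n => (3 / 2) ^ n * (Real.exp (-1) * cosCoeff (2 * β) (freq n).natAbs))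
      (fun n => by have := hnn n; positivity) (fun n t ht htn => ?_) (by linarith)
      (not_summable_geom_rpow_of_tendsto hc (Real.exp_pos _) (by norm_num) hlim (by linarith)) hτ
    have h := SchauderBasis.le_norm_orbit hK (r := 3) (by norm_num) (by norm_num)
      (weightedCoord_weightedExpLp_neg h1) hnn n ht htn
    rwa [← mul_assoc, ← mul_pow, mul_div_cancel₀ _ two_ne_zero]
  · obtain ⟨h0, h1, h2⟩ := key q hq β hβ
    set e := weightedBasis h0 h1 with he
    obtain ⟨K, hK⟩ : ∃ K : ℝ, ∀ n, ‖e.coord n‖ ≤ K := exists_norm_weightedCoord_le h1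
    obtain ⟨c, hc, hlim⟩ := tendsto_cosCoeff (q := q) (by linarith)
    rw [← h2] at hlim
    have hβ0 : 0 < 2 * β := by
      have : 1 / q < 1 := (div_lt_one (by linarith)).2 (by linarith)
      linarith
    have hnn : ∀ n, 0 ≤ cosCoeff (2 * β) (freq n).natAbs := fun n =>
      cosCoeff_nonneg hβ0 (by linarith) _
    have hcoef : ∀ n, e.coord n (weightedExpLp (-β) 0) = (cosCoeff (2 * β) (freq n).natAbs : ℂ) :=
      weightedCoord_weightedExpLp_neg h1
    refine ⟨e, SchauderBasis.semigroup e, SchauderBasis.observation e 2, weightedExpLp (-β) 0,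
      fun n => cosCoeff (2 * β) (freq n).natAbs,
      fun n => coeFn_weightedExpLp (by linarith) n, ?_, SchauderBasis.isExpStable_semigroup e,
      SchauderBasis.isBoundedAnalytic_semigroup e,
      fun y t ht => (SchauderBasis.semigroup_mem_domain e y ht).1,
      fun n t ht => SchauderBasis.semigroup_basis e ht n, fun n => ?_,
      SchauderBasis.weiss_observation hK, SchauderBasis.lorentzAdmissible_observation hK, ?_,
      hcoef, hnn, ⟨c, hc, hlim⟩, fun p hp hpq τ hτ => ?_⟩
    · rintro ⟨u, hu⟩
      -- Conditionality: coefficients of order `n^{-1/q}` are not square summable since `2 ≤ q`,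
      -- against Orlicz.
      refine not_summable_rpow_of_tendsto hc one_pos (by linarith) hlim two_pos hq.le ?_
      refine (summable_norm_coord_sq hu hK (weightedExpLp (-β) 0)).congr fun n => ?_
      rw [hcoef, Complex.norm_real, Real.norm_eq_abs, sq_abs, one_mul, Real.rpow_two]
    · obtain ⟨h, hn⟩ := SchauderBasis.observation_basis hK (r := 2) (by norm_num) (by norm_num) n
      exact ⟨h, by rw [hn, Complex.ofReal_ofNat]⟩
    · filter_upwards [coeFn_weightedExpLp (w := -β) (by linarith) 0] with s hs
      have hf0 : freq 0 = 0 := by simp [freq]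
      rw [hs, weightedExp, hf0, Int.cast_zero, mul_zero, zero_mul, Complex.exp_zero, mul_one]
    · exact not_memLorentz_of_not_summable
        (b := fun n => Real.exp (-1) * cosCoeff (2 * β) (freq n).natAbs)
        (fun n => by have := hnn n; positivity)
        (fun n t ht htn => SchauderBasis.le_norm_orbit hK (r := 2) (by norm_num) (by norm_num)
          hcoef hnn n ht htn) (by linarith)
        (not_summable_rpow_of_tendsto hc (Real.exp_pos _) (by linarith) hlim (by linarith) hpq) hτ
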